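/- Let $d\ge 2$, let $\Omega_d$ be the unit sphere of $\mathbb{C}^d$, let $\sigma_d$ be a positive constant multiple of the surface (Lebesgue) measure on $\Omega_d$ (for example the surface measure itself, or the normalized one), let $\omega_d=\sigma_d(\Omega_d)$, and let $\|\cdot\|_p$ be the norm of $L^p(\Omega_d,\sigma_d)$. For $m,n\in\mathbb{N}=\{0,1,2,\dots\}$ let $\mathcal{H}_{m,n}$ be the space of restrictions to $\Omega_d$ of the polynomials in $z,\overline{z}$ that are homogeneous of degree $m$ in $z$ and of degree $n$ in $\overline z$ and are annihilated by $4\sum_{j=1}^d \partial^2/\partial z_j\partial\overline z_j$. Put $$\mathcal{H}_l=\bigoplus_{\max\{m,n\}=l}\mathcal{H}_{m,n},\quad d_l=\dim_{\mathbb C}\mathcal{H}_l,\quad \mathcal{T}_{M_1,M_2}=\bigoplus_{l=M_1+1}^{M_2}\mathcal{H}_l,\quad s=\dim_{\mathbb C}\mathcal{T}_{M_1,M_2},$$ where $M_1<M_2$ are natural numbers. Let $\{\xi_k\}_{k=1}^s$ be an orthonormal basis of $\mathcal{T}_{M_1,M_2}$ in $L^2(\Omega_d,\sigma_d)$ that is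 a union of bases of the spaces $\mathcal{H}_l$, $M_1<l\le M_2$ (the functions $\xi_k$ may be chosen real-valued, but need not be). For $\alpha\in\mathbb{R}^s$ let $J(\alpha)=\sum_k\alpha_k\xi_k$. Let $\lambda:[0,\infty)\to\mathbb{R}$ be positive, let $\Lambda_s\big(\sum_k\alpha_k\xi_k\big)=\sum_k\widetilde\lambda_k\alpha_k\xi_k$ with $\widetilde\lambda_k=\lambda(l)$ if $\xi_k\in\mathcal{H}_l$ (that is, $\mathcal{H}_{m,n}$ has the multiplier $\lambda(\max\{m,n\})$), and let $\|\alpha\|_{(\Lambda_s,p)}=\|\Lambda_sJ(\alpha)\|_p$. The Levy mean of a norm on $\mathbb{R}^s$ is $M(\|\cdot\|)=\big(\int_{S^{s-1}}\|x\|^2\,d\mu(x)\big)^{1/2}$, with $\mu$ the normalized Lebesgue measure on the Euclidean unit sphere $S^{s-1}$. Put $$W=s^{-1/2}\Big(\sum_{l=M_1+1}^{M_2}\lambda(l)^2d_l\Big)^{1/2},\qquad W'=s^{-1/2}\Big(\sum_{l=M_1+1}^{M_2}\lambda(l-1)^2d_l\Big)^{1/2}.$$ There are an absolute constant $C>0$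 and, for each $d\geq 2$, a constant $C_d>0$ depending only on $d$, such that in the above situation, if $\lambda$ is non-increasing, then: (a) if $2\le p<\infty$, then $\ \omega_d^{1/p-1/2}\,W\le M(\|\cdot\|_{(\Lambda_s,p)})\le C\,\omega_d^{1/p-1/2}\,p^{1/2}\,W'$; (b) if $p=\infty$, then $\ \omega_d^{-1/2}\,W\le M(\|\cdot\|_{(\Lambda_s,\infty)})\le C_d\,\omega_d^{-1/2}(\ln s)^{1/2}\,W'$; (c) if $1\le p\le 2$, then $\ \tfrac12\,\omega_d^{1/p-1/2}\,W\le M(\|\cdot\|_{(\Lambda_s,p)})\le \omega_d^{1/p-1/2}\,W'$; (d) if $p=2$, then $\ W\le M(\|\cdot\|_{(\Lambda_s,2)})\le W'$. If $\lambda$ is non-decreasing, then (a), (b), (c) and (d) hold with $W$ and $W'$ interchanged. -/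

import Mathlib

open MeasureTheory
open scoped NNReal ENNReal ComplexConjugate

noncomputable section

/-- The unit sphere of `ℂ^d`. -/
abbrev CSphere (d : ℕ) : Type :=
  Metric.sphere (0 : EuclideanSpace ℂ (Fin d)) 1

/-- `c` times the surface (Lebesgue) measure on the unit sphere of `ℂ^d = ℝ^{2d}`.
For `c = 1` the total mass is the surface area of the sphere. -/
def sphereMeasure (d : ℕ) (c : ℝ≥0) : Measure (CSphere d) :=
  c • (volume : Measure (EuclideanSpace ℂ (Fin d))).toSphere

/-- The total mass of `sphereMeasure d c`. -/
def sphereMass (d : ℕ) (c : ℝ≥0) : ℝ :=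
  (sphereMeasure d c).real Set.univ

/-- Polynomials in `z` and `conj z`: the variable `Sum.inl j` stands for `z j`, the variable
`Sum.inr j` for the conjugate of `z j`. -/
abbrev ZPoly (d : ℕ) : Type :=
  MvPolynomial (Fin d ⊕ Fin d) ℂ

/-- The weights that make the weighted degree of a monomial equal to its bidegree: its degree in
`z` and its degree in `conj z`. -/
def bidegreeWeight (d : ℕ) : Fin d ⊕ Fin d → ℕ × ℕ :=
  Sum.elim (fun _ => (1, 0)) (fun _ => (0, 1))

/-- The complex Laplacian `4 ∑ j, ∂² / (∂ z_j ∂ conj z_j)` on polynomials. -/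
def complexLaplacian (d : ℕ) : ZPoly d →ₗ[ℂ] ZPoly d :=
  (4 : ℂ) • ∑ j : Fin d,
    ((MvPolynomial.pderiv (Sum.inl j) : Derivation ℂ (ZPoly d) (ZPoly d)) :
        ZPoly d →ₗ[ℂ] ZPoly d) ∘ₗ
      ((MvPolynomial.pderiv (Sum.inr j) : Derivation ℂ (ZPoly d) (ZPoly d)) :
        ZPoly d →ₗ[ℂ] ZPoly d)

/-- Restriction of a polynomial in `z` and `conj z` to the unit sphere. -/
def restrictToSphere (d : ℕ) : ZPoly d →ₗ[ℂ] (CSphere d → ℂ) :=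
  LinearMap.pi fun z =>
    (MvPolynomial.aeval (R := ℂ)
      (Sum.elim (fun j => z.1 j) (fun j => conj (z.1 j)) : Fin d ⊕ Fin d → ℂ)).toLinearMap

/-- The complex spherical harmonics of bidegree `(m, n)`. -/
def sphericalHarmonics (d m n : ℕ) : Submodule ℂ (CSphere d → ℂ) :=
  (MvPolynomial.weightedHomogeneousSubmodule ℂ (bidegreeWeight d) (m, n) ⊓
    LinearMap.ker (complexLaplacian d)).map (restrictToSphere d)

/-- `𝓗_l`, the sum of the spaces of bidegree `(m, n)` with `max m n = l`. -/
def shell (d l : ℕ) : Submodule ℂ (CSphere d → ℂ) :=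
  ⨆ (m : ℕ) (n : ℕ) (_ : max m n = l), sphericalHarmonics d m n

/-- `d_l`, the dimension of `𝓗_l`. -/
def shellDim (d l : ℕ) : ℕ :=
  Module.finrank ℂ (shell d l)

/-- `𝓣_{M₁,M₂}`, the sum of the `𝓗_l` with `M₁ < l ≤ M₂`. -/
def harmonicBand (d M₁ M₂ : ℕ) : Submodule ℂ (CSphere d → ℂ) :=
  ⨆ l ∈ Finset.Ioc M₁ M₂, shell d l

/-- `s`, the dimension of `𝓣_{M₁,M₂}`. -/
def bandDim (d M₁ M₂ : ℕ) : ℕ :=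
  Module.finrank ℂ (harmonicBand d M₁ M₂)

/-- `ξ` is an orthonormal system of `L²(sphereMeasure d c)` made up of bases of the spaces `𝓗_l`
with `M₁ < l ≤ M₂`; the function `ξ k` belongs to the basis of `𝓗_{deg k}`.  The `ξ k` may be
real-valued, and they may be of pure bidegree, but neither is required. -/
structure IsAdaptedBasis (d : ℕ) (c : ℝ≥0) (M₁ M₂ : ℕ) {s : ℕ}
    (ξ : Fin s → CSphere d → ℂ) (deg : Fin s → ℕ) : Prop where
  deg_mem : ∀ k, deg k ∈ Finset.Ioc M₁ M₂
  orthonormal : ∀ j k,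
    ∫ z, ξ j z * conj (ξ k z) ∂(sphereMeasure d c) = if j = k then 1 else 0
  span_eq : ∀ l ∈ Finset.Ioc M₁ M₂,
    Submodule.span ℂ (ξ '' {k | deg k = l}) = shell d l

/-- The coordinate map `J α = ∑ k, α_k ξ_k`, for real coordinates `α`. -/
def coordMap {d s : ℕ} (ξ : Fin s → CSphere d → ℂ) (α : EuclideanSpace ℝ (Fin s)) :
    CSphere d → ℂ :=
  fun z => ∑ k, (α k : ℂ) * ξ k z

/-- The multiplier operator `Λ_s` in coordinates: the coordinate of a basis function in `𝓗_l` is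
multiplied by `lam l` (recall that `λ_{m,n} = lam (max m n) = lam l` there). -/
def multiplierOp {s : ℕ} (lam : ℝ≥0 → ℝ) (deg : Fin s → ℕ) (α : EuclideanSpace ℝ (Fin s)) :
    EuclideanSpace ℝ (Fin s) :=
  WithLp.toLp 2 fun k => lam (deg k) * α k

/-- The norm `α ↦ ‖Λ_s (J α)‖_p` on `ℝ^s`, with the `L^p` norm of `sphereMeasure d c`. -/
def multiplierNorm {d s : ℕ} (c : ℝ≥0) (ξ : Fin s → CSphere d → ℂ) (deg : Fin s → ℕ)
    (lam : ℝ≥0 → ℝ) (p : ℝ≥0∞) (α : EuclideanSpace ℝ (Fin s)) : ℝ :=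
  (eLpNorm (coordMap ξ (multiplierOp lam deg α)) p (sphereMeasure d c)).toReal

/-- The Levy mean `(∫ N(x)² dμ(x))^{1/2}` over the Euclidean unit sphere of `ℝ^n`, where `μ` is
the normalized surface measure. -/
def levyMean {n : ℕ} (N : EuclideanSpace ℝ (Fin n) → ℝ) : ℝ :=
  √(⨍ x : Metric.sphere (0 : EuclideanSpace ℝ (Fin n)) 1, N x ^ 2
      ∂(volume : Measure (EuclideanSpace ℝ (Fin n))).toSphere)

/-- `s^{-1/2} (∑_{M₁ < l ≤ M₂} (w l)² d_l)^{1/2}`. -/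
def weightedMean (d M₁ M₂ : ℕ) (w : ℕ → ℝ) : ℝ :=
  (bandDim d M₁ M₂ : ℝ) ^ (-(1 / 2) : ℝ) *
    √(∑ l ∈ Finset.Ioc M₁ M₂, w l ^ 2 * (shellDim d l : ℝ))

end

/-!
The coordinates of a random point of `S^{s-1}` are uncorrelated with variance `1 / s`, so for `F_α
= ∑ k, α_k λ̃_k ξ_k` the second moment `E |F_α(z)|²` is `(1 / s) ∑ k, λ̃_k² |ξ_k(z)|²`. The spaces
`𝓗_l` are invariant under the unitary group, because unitary substitutions preserve bidegrees and
commute with the Laplacian; hence a unitary map acts on an orthonormal basis of `𝓗_l` by a unitary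
matrix, and since the group is transitive on the sphere, `∑ |ξ_k(z)|²` over the basis of `𝓗_l` is
the constant `d_l / ω_d` (`IsOrthonormalFamily.sum_norm_sq`). So `E |F_α(z)|² = V` with `ω_d V =
W²` for every `z`. All the estimates hold with the mean `W` of `λ` itself on both sides
(`IsAdaptedBasis.levyMean_bounds`); monotonicity of `λ` then only compares `W` with `W'`.

* For `p = 2`, Fubini's theorem gives the Levy mean exactly, and Hölder's inequality gives the
  lower bounds for `p ≥ 2` and the upper bounds for `p ≤ 2`.
* For `2 ≤ p < ∞`, it suffices to treat an even exponent `2m`, where Jensen's inequality and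
  Fubini's theorem reduce the claim to the moments of linear forms on `S^{s-1}`. These are
  obtained by integrating `⟪u, x⟫ ^ (2m)` over `u` in the sphere and over a standard Gaussian `x`:
  rotation invariance gives `E ⟪u, v⟫ ^ (2m) = ‖v‖ ^ (2m) (2m - 1)‼ / E ‖x‖ ^ (2m)`
  (`integral_inner_pow_sphereProb`), and `E ‖x‖ ^ (2m) ≥ s ^ m`. A convexity argument extends the
  bound to complex coefficients with the same constant.
* For `1 ≤ p ≤ 2`, the lower bound follows from the one for `p = 1`, that is, from `E |F_α(z)| ≥
  (1/2) V^{1/2}`, a consequence of `E |F_α(z)|⁴ ≤ 3 V²` (`le_integral_norm_sum_sphereProb`).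
* For `p = ∞`, the function `F_α ^ m` is a polynomial of degree at most `2 m M₂`, and in an
  invariant space of dimension `D` one has `|G(z)|² ≤ (D / ω_d) ‖G‖_2²`. Hence `‖F_α‖_∞ ≤ (D /
  ω_d)^{1/(2m)} ‖F_α‖_{2m}` with `D ≤ (2 m M₂ + 1)^{2d}`. Since `M₂ < s` (`lt_bandDim`), the
  choice `m = ⌈log s⌉` makes `D^{1/(2m)}` bounded in terms of `d` alone, and the bound for the
  exponent `2m` finishes the proof.
-/

/-! ### Rotations of the sphere and Gaussian moments -/

section Rotation

variable {𝕜 E : Type*} [RCLike 𝕜] [NormedAddCommGroup E] [NormedSpace 𝕜 E]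

/-- The action of a linear isometry equivalence on the unit sphere. -/
def sphereRotation (U : E ≃ₗᵢ[𝕜] E) (x : Metric.sphere (0 : E) 1) : Metric.sphere (0 : E) 1 :=
  ⟨U x, by simp⟩

@[simp]
lemma coe_sphereRotation (U : E ≃ₗᵢ[𝕜] E) (x : Metric.sphere (0 : E) 1) :
    (sphereRotation U x : E) = U x := rfl

lemma sphereRotation_symm_apply (U : E ≃ₗᵢ[𝕜] E) (x : Metric.sphere (0 : E) 1) :
    sphereRotation U (sphereRotation U.symm x) = x := by
  ext; simp

lemma continuous_sphereRotation (U : E ≃ₗᵢ[𝕜] E) : Continuous (sphereRotation U) := by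
  unfold sphereRotation
  fun_prop

open scoped Pointwise in
/-- The spherical part of a measure inherits the invariance of the measure under linear
isometries, because it is the measure of cones. -/
lemma measurePreserving_sphereRotation [NormedSpace ℝ E] [LinearMap.CompatibleSMul E E ℝ 𝕜]
    [MeasurableSpace E] [BorelSpace E] {μ : Measure E} (U : E ≃ₗᵢ[𝕜] E)
    (hU : MeasurePreserving U μ μ) :
    MeasurePreserving (sphereRotation U) μ.toSphere μ.toSphere := by
  have hm := (continuous_sphereRotation U).measurable
  refine ⟨hm, Measure.ext fun t ht => ?_⟩
  rw [Measure.map_apply hm ht, Measure.toSphere_apply' _ (hm ht), Measure.toSphere_apply' _ ht]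
  congr 1
  have hs : Set.Ioo (0 : ℝ) 1 • ((↑) '' (sphereRotation U ⁻¹' t) : Set E)
      = U ⁻¹' (Set.Ioo (0 : ℝ) 1 • ((↑) '' t : Set E)) := by
    ext x
    simp only [Set.mem_smul, Set.mem_image, Set.mem_preimage]
    constructor
    · rintro ⟨r, hr, _, ⟨y, hy, rfl⟩, rfl⟩
      exact ⟨r, hr, _, ⟨_, hy, rfl⟩, (U.toLinearEquiv.toLinearMap.map_smul_of_tower r _).symm⟩
    · rintro ⟨r, hr, _, ⟨y, hy, rfl⟩, h⟩
      refine ⟨r, hr, _, ⟨sphereRotation U.symm y, ?_, rfl⟩, ?_⟩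
      · rwa [sphereRotation_symm_apply]
      · apply U.injective
        rw [← h]
        have := U.toLinearEquiv.toLinearMap.map_smul_of_tower r ((sphereRotation U.symm y : _) : E)
        refine this.trans ?_
        simp
  have hU' : MeasurableEmbedding U := U.toHomeomorph.measurableEmbedding
  rw [hs, hU.measure_preimage_emb hU']

end Rotation

/-- A unitary map preserves the volume of `ℂ^d`. -/
lemma measurePreserving_unitary {d : ℕ}
    (U : EuclideanSpace ℂ (Fin d) ≃ₗᵢ[ℂ] EuclideanSpace ℂ (Fin d)) :
    MeasurePreserving U volume volume :=
  LinearIsometryEquiv.measurePreserving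
    (⟨U.toLinearEquiv.restrictScalars ℝ, U.norm_map⟩ :
      EuclideanSpace ℂ (Fin d) ≃ₗᵢ[ℝ] EuclideanSpace ℂ (Fin d))

/-- The isometry group acts transitively on spheres. -/
lemma exists_linearIsometryEquiv_apply_eq {𝕜 V : Type*} [RCLike 𝕜] [NormedAddCommGroup V]
    [InnerProductSpace 𝕜 V] [FiniteDimensional 𝕜 V] {x y : V} (h : ‖x‖ = ‖y‖) :
    ∃ U : V ≃ₗᵢ[𝕜] V, U x = y := by
  by_cases hx : x = 0
  · subst hx
    exact ⟨LinearIsometryEquiv.refl 𝕜 V, by simpa [eq_comm] using h⟩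
  let f : 𝕜 ∙ x →ₗ[𝕜] V :=
    (LinearMap.toSpanSingleton 𝕜 V y) ∘ₗ (LinearEquiv.toSpanNonzeroSingleton 𝕜 V x hx).symm
  have hf (c : 𝕜) (hc) : f ⟨c • x, hc⟩ = c • y := by
    have : (⟨c • x, hc⟩ : 𝕜 ∙ x) = LinearEquiv.toSpanNonzeroSingleton 𝕜 V x hx c := by
      ext; simp
    simp only [f, LinearMap.comp_apply, LinearEquiv.coe_coe]
    rw [this, LinearEquiv.symm_apply_apply]
    simp
  let g : 𝕜 ∙ x →ₗᵢ[𝕜] V := ⟨f, by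
    rintro ⟨z, hz⟩
    obtain ⟨c, rfl⟩ := Submodule.mem_span_singleton.1 hz
    rw [hf, Submodule.coe_norm, norm_smul, norm_smul, h]⟩
  refine ⟨g.extend.toLinearIsometryEquiv rfl, ?_⟩
  have := g.extend_apply ⟨x, Submodule.mem_span_singleton_self x⟩
  simp only [LinearIsometry.coe_toLinearIsometryEquiv]
  rw [show g.extend x = _ from this]
  have := hf 1 (by simp)
  simp only [one_smul] at this
  exact this

/-- The even moments of the standard normal distribution. -/
lemma integral_pow_gaussianReal (m : ℕ) :
    ∫ x, x ^ (2 * m) ∂(ProbabilityTheory.gaussianReal 0 1) = (2 * m - 1).doubleFactorial := by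
  rw [ProbabilityTheory.integral_gaussianReal_eq_integral_smul one_ne_zero]
  let f : ℝ → ℝ := fun y => (√(2 * Real.pi))⁻¹ *
    (y ^ ((2 * m : ℕ) : ℝ) * Real.exp (-(1 / 2) * y ^ (2 : ℝ)))
  have h1 : ∀ x : ℝ, ProbabilityTheory.gaussianPDFReal 0 1 x • x ^ (2 * m) = f |x| := by
    intro x
    simp only [f, ProbabilityTheory.gaussianPDFReal_def, Real.rpow_natCast, Real.rpow_two, sq_abs,
      smul_eq_mul, pow_mul, NNReal.coe_one, sub_zero, mul_one]
    rw [show -x ^ 2 / 2 = -(1 / 2) * x ^ 2 by ring]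
    ring
  rw [integral_congr_ae (.of_forall h1), integral_comp_abs (f := f), integral_const_mul,
    integral_rpow_mul_exp_neg_mul_rpow two_pos
      (by linarith [Nat.cast_nonneg (α := ℝ) (2 * m)]) (by norm_num)]
  rw [show (((2 * m : ℕ) : ℝ) + 1) / 2 = m + 1 / 2 by push_cast; ring,
    show -(((2 * m : ℕ) : ℝ) + 1) / 2 = -((m : ℝ) + 1 / 2) by push_cast; ring,
    Real.Gamma_nat_add_half, Real.rpow_neg (by norm_num), Real.rpow_add (by norm_num),
    Real.rpow_natCast, ← Real.sqrt_eq_rpow, Real.sqrt_mul two_pos.le, Real.sqrt_div zero_le_one]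
  have h2 : √(2 : ℝ) ≠ 0 := by positivity
  have h3 : √Real.pi ≠ 0 := by positivity
  field_simp
  simp

lemma doubleFactorial_le_pow (m : ℕ) : (2 * m - 1).doubleFactorial ≤ (2 * m) ^ m := by
  induction m with
  | zero => simp
  | succ k ih =>
    rcases k with _ | k
    · simp
    · rw [show 2 * (k + 1 + 1) - 1 = (2 * (k + 1) - 1) + 2 by omega, Nat.doubleFactorial_add_two,
        pow_succ, mul_comm]
      refine Nat.mul_le_mul (ih.trans (Nat.pow_le_pow_left (by omega) _)) (by omega)

/-! ### Moments of linear forms on the real sphere -/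

/-- The normalized surface measure on the unit sphere of `ℝ^n`. -/
noncomputable def sphereProb (n : ℕ) :
    Measure (Metric.sphere (0 : EuclideanSpace ℝ (Fin n)) 1) :=
  ((volume : Measure (EuclideanSpace ℝ (Fin n))).toSphere Set.univ)⁻¹ •
    (volume : Measure (EuclideanSpace ℝ (Fin n))).toSphere

lemma levyMean_eq {n : ℕ} (N : EuclideanSpace ℝ (Fin n) → ℝ) :
    levyMean N = √(∫ x, N (x : EuclideanSpace ℝ (Fin n)) ^ 2 ∂(sphereProb n)) := rfl

instance isProbabilityMeasure_sphereProb (n : ℕ) [NeZero n] :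
    IsProbabilityMeasure (sphereProb n) := by
  have : Nontrivial (EuclideanSpace ℝ (Fin n)) := by
    have : Nonempty (Fin n) := ⟨0⟩
    infer_instance
  have : NeZero ((volume : Measure (EuclideanSpace ℝ (Fin n))).toSphere) :=
    ⟨Measure.toSphere_ne_zero _⟩
  unfold sphereProb
  infer_instance

lemma integral_sphereProb_rotation {n : ℕ}
    (U : EuclideanSpace ℝ (Fin n) ≃ₗᵢ[ℝ] EuclideanSpace ℝ (Fin n))
    {f : Metric.sphere (0 : EuclideanSpace ℝ (Fin n)) 1 → ℝ} (hf : Continuous f) :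
    ∫ x, f (sphereRotation U x) ∂(sphereProb n) = ∫ x, f x ∂(sphereProb n) := by
  have h := measurePreserving_sphereRotation U U.measurePreserving
  unfold sphereProb
  rw [integral_smul_measure, integral_smul_measure, ← h.map_eq,
    integral_map h.measurable.aemeasurable hf.aestronglyMeasurable, h.map_eq]

/-- Rotation invariance makes the even moments of a linear form a function of its norm. -/
lemma exists_integral_inner_pow_sphereProb (n k : ℕ) [NeZero n] :
    ∃ A : ℝ, ∀ v : EuclideanSpace ℝ (Fin n),
      ∫ u, inner ℝ (u : EuclideanSpace ℝ (Fin n)) v ^ k ∂(sphereProb n) = ‖v‖ ^ k * A := by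
  have : Nonempty (Fin n) := ⟨0⟩
  obtain ⟨e, he⟩ := exists_norm_eq (EuclideanSpace ℝ (Fin n)) zero_le_one
  refine ⟨∫ u, inner ℝ (u : EuclideanSpace ℝ (Fin n)) e ^ k ∂(sphereProb n), fun v => ?_⟩
  obtain ⟨U, hU⟩ := exists_linearIsometryEquiv_apply_eq (𝕜 := ℝ) (x := ‖v‖ • e) (y := v)
    (by simp [norm_smul, he])
  rw [← integral_const_mul, ← integral_sphereProb_rotation U (by fun_prop)]
  congr 1 with u
  conv_lhs => rw [← hU, coe_sphereRotation, U.inner_map_map, inner_smul_right, mul_pow]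

lemma integral_inner_pow_stdGaussian {n : ℕ} (m : ℕ) (v : EuclideanSpace ℝ (Fin n)) :
    ∫ x, inner ℝ v x ^ (2 * m) ∂(ProbabilityTheory.stdGaussian (EuclideanSpace ℝ (Fin n)))
      = ‖v‖ ^ (2 * m) * (2 * m - 1).doubleFactorial := by
  have h := ProbabilityTheory.IsGaussian.map_eq_gaussianReal
    (μ := ProbabilityTheory.stdGaussian (EuclideanSpace ℝ (Fin n))) (innerSL ℝ v)
  rw [ProbabilityTheory.integral_strongDual_stdGaussian,
    ProbabilityTheory.variance_dual_stdGaussian, innerSL_apply_norm] at h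
  have h2 : ∫ y, y ^ (2 * m) ∂(ProbabilityTheory.gaussianReal 0 (‖v‖ ^ 2).toNNReal)
      = ‖v‖ ^ (2 * m) * (2 * m - 1).doubleFactorial := by
    rw [← integral_pow_gaussianReal, ← integral_const_mul]
    have h3 := ProbabilityTheory.gaussianReal_map_const_mul (μ := 0) (v := 1) ‖v‖
    rw [mul_zero, mul_one] at h3
    rw [show (‖v‖ ^ 2).toNNReal = .mk (‖v‖ ^ 2) (sq_nonneg _) by
      ext; simp, ← h3, integral_map (by fun_prop) (by fun_prop)]
    simp_rw [mul_pow]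
  rw [← h2, ← h, integral_map (by fun_prop) (by fun_prop)]
  simp

lemma integrable_norm_pow_stdGaussian (n k : ℕ) :
    Integrable (fun x : EuclideanSpace ℝ (Fin n) => ‖x‖ ^ k)
      (ProbabilityTheory.stdGaussian (EuclideanSpace ℝ (Fin n))) :=
  ((ProbabilityTheory.IsGaussian.memLp_id
    (ProbabilityTheory.stdGaussian (EuclideanSpace ℝ (Fin n))) k (by simp))).integrable_norm_pow'

lemma integral_norm_sq_stdGaussian (n : ℕ) :
    ∫ x, ‖x‖ ^ 2 ∂(ProbabilityTheory.stdGaussian (EuclideanSpace ℝ (Fin n))) = n := by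
  have h (i : Fin n) := integral_inner_pow_stdGaussian 1 (EuclideanSpace.single i (1 : ℝ))
  simp only [EuclideanSpace.inner_single_left] at h
  simp only [mul_one, map_one, one_mul, PiLp.norm_single, norm_one, one_pow] at h
  simp_rw [EuclideanSpace.norm_sq_eq, Real.norm_eq_abs, sq_abs]
  rw [integral_finsetSum]
  · simp [h]
  · intro i _
    refine (integrable_norm_pow_stdGaussian n 2).mono' (by fun_prop) (.of_forall fun x => ?_)
    rw [norm_pow]
    gcongr
    exact PiLp.norm_apply_le x i

/-- Integrating `⟪u, x⟫ ^ (2 m)` over the sphere in `u` and over the standard Gaussian in `x`, in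
both orders, gives the moments of linear forms on the sphere. -/
lemma integral_inner_pow_sphereProb (n m : ℕ) [NeZero n] (v : EuclideanSpace ℝ (Fin n)) :
    (∫ u, inner ℝ (u : EuclideanSpace ℝ (Fin n)) v ^ (2 * m) ∂(sphereProb n)) *
      ∫ x, ‖x‖ ^ (2 * m) ∂(ProbabilityTheory.stdGaussian (EuclideanSpace ℝ (Fin n)))
      = ‖v‖ ^ (2 * m) * (2 * m - 1).doubleFactorial := by
  obtain ⟨A, hA⟩ := exists_integral_inner_pow_sphereProb n (2 * m)
  have hsw := integral_integral_swap (μ := sphereProb n)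
    (ν := ProbabilityTheory.stdGaussian (EuclideanSpace ℝ (Fin n)))
    (f := fun u x => inner ℝ (u : EuclideanSpace ℝ (Fin n)) x ^ (2 * m)) (by
      refine ((integrable_norm_pow_stdGaussian n (2 * m)).comp_snd (sphereProb n)).mono'
        (by unfold Function.uncurry; fun_prop) (.of_forall fun p => ?_)
      simp only [Function.uncurry, norm_pow]
      gcongr
      refine (norm_inner_le_norm _ _).trans ?_
      simp)
  simp_rw [hA, integral_inner_pow_stdGaussian] at hsw
  rw [integral_mul_const] at hsw
  simp at hsw
  rw [hA, hsw, integral_mul_const]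
  ring

lemma integral_inner_sq_sphereProb (n : ℕ) [NeZero n] (v : EuclideanSpace ℝ (Fin n)) :
    ∫ u, inner ℝ (u : EuclideanSpace ℝ (Fin n)) v ^ 2 ∂(sphereProb n) = ‖v‖ ^ 2 / n := by
  have h := integral_inner_pow_sphereProb n 1 v
  rw [mul_one, integral_norm_sq_stdGaussian] at h
  rw [eq_div_iff (by exact_mod_cast NeZero.ne n), h]
  simp

lemma pow_le_integral_norm_pow_stdGaussian (n m : ℕ) :
    (n : ℝ) ^ m ≤
      ∫ x, ‖x‖ ^ (2 * m) ∂(ProbabilityTheory.stdGaussian (EuclideanSpace ℝ (Fin n))) := by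
  have h := (convexOn_pow (𝕜 := ℝ) m).map_integral_le
    (μ := ProbabilityTheory.stdGaussian (EuclideanSpace ℝ (Fin n))) (f := fun x => ‖x‖ ^ 2)
    (by fun_prop) isClosed_Ici (.of_forall fun x => Set.mem_Ici.2 (by positivity))
    (integrable_norm_pow_stdGaussian n 2)
    (by simpa only [Function.comp_def, ← pow_mul] using integrable_norm_pow_stdGaussian n (2 * m))
  simpa only [integral_norm_sq_stdGaussian, ← pow_mul] using h

lemma integral_inner_pow_sphereProb_le (n m : ℕ) [NeZero n] (v : EuclideanSpace ℝ (Fin n)) :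
    ∫ u, inner ℝ (u : EuclideanSpace ℝ (Fin n)) v ^ (2 * m) ∂(sphereProb n)
      ≤ (2 * m - 1).doubleFactorial * (‖v‖ ^ 2 / n) ^ m := by
  have hn : (0 : ℝ) < n := by exact_mod_cast Nat.pos_of_ne_zero (NeZero.ne n)
  rw [div_pow, ← mul_div_assoc, le_div_iff₀ (by positivity), mul_comm _ ((‖v‖ ^ 2) ^ m), ← pow_mul,
    ← integral_inner_pow_sphereProb n m v]
  refine mul_le_mul_of_nonneg_left (pow_le_integral_norm_pow_stdGaussian n m)
    (integral_nonneg fun u => ?_)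
  rw [pow_mul]
  positivity

/-- Continuous functions on the sphere are integrable. -/
lemma Continuous.integrable_sphereProb {n : ℕ} [NeZero n]
    {f : Metric.sphere (0 : EuclideanSpace ℝ (Fin n)) 1 → ℝ} (hf : Continuous f) :
    Integrable f (sphereProb n) :=
  hf.integrable_of_hasCompactSupport (HasCompactSupport.of_compactSpace f)

/-- The constant in the moment bound does not change when one form is replaced by the Euclidean
norm of a pair: `X² + Y²` is a convex combination of suitably normalized squares. -/
lemma integral_inner_pair_pow_sphereProb_le (n m : ℕ) [NeZero n]
    (v w : EuclideanSpace ℝ (Fin n)) :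
    ∫ u, (inner ℝ (u : EuclideanSpace ℝ (Fin n)) v ^ 2 +
        inner ℝ (u : EuclideanSpace ℝ (Fin n)) w ^ 2) ^ m ∂(sphereProb n)
      ≤ (2 * m - 1).doubleFactorial * ((‖v‖ ^ 2 + ‖w‖ ^ 2) / n) ^ m := by
  have hn : (0 : ℝ) < n := by exact_mod_cast Nat.pos_of_ne_zero (NeZero.ne n)
  rcases eq_or_ne v 0 with rfl | hv
  · rcases eq_or_ne m 0 with rfl | hm
    · simp
    · simpa [← pow_mul] using integral_inner_pow_sphereProb_le n m w
  rcases eq_or_ne w 0 with rfl | hw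
  · simpa [← pow_mul] using integral_inner_pow_sphereProb_le n m v
  have hv' : 0 < ‖v‖ ^ 2 := by positivity
  have hw' : 0 < ‖w‖ ^ 2 := by positivity
  set a := ‖v‖ ^ 2
  set b := ‖w‖ ^ 2
  have hab : 0 < a + b := by positivity
  -- convexity of `t ↦ t ^ m` with weights proportional to `‖v‖²` and `‖w‖²`
  have hpt (x y : ℝ) : (x ^ 2 + y ^ 2) ^ m ≤
      (a + b) ^ m *
        (a / (a + b) * (x ^ (2 * m) / a ^ m) + b / (a + b) * (y ^ (2 * m) / b ^ m)) := by
    have h := (convexOn_pow (𝕜 := ℝ) m).2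
      (show x ^ 2 / a ∈ Set.Ici 0 from Set.mem_Ici.2 (by positivity))
      (show y ^ 2 / b ∈ Set.Ici 0 from Set.mem_Ici.2 (by positivity))
      (show 0 ≤ a / (a + b) by positivity) (show 0 ≤ b / (a + b) by positivity) (by field_simp)
    simp only [smul_eq_mul, div_pow, ← pow_mul] at h
    refine le_trans (le_of_eq ?_) (mul_le_mul_of_nonneg_left h (by positivity))
    rw [← mul_pow]
    congr 1
    field_simp
  refine (integral_mono (Continuous.integrable_sphereProb (by fun_prop))
    (Continuous.integrable_sphereProb (by fun_prop)) fun u => hpt _ _).trans ?_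
  rw [integral_const_mul, integral_add (Continuous.integrable_sphereProb (by fun_prop))
    (Continuous.integrable_sphereProb (by fun_prop)), integral_const_mul, integral_const_mul,
    integral_div, integral_div]
  have h1 := integral_inner_pow_sphereProb_le n m v
  have h2 := integral_inner_pow_sphereProb_le n m w
  calc _ ≤ (a + b) ^ m * (a / (a + b) * ((2 * m - 1).doubleFactorial * (a / n) ^ m / a ^ m)
      + b / (a + b) * ((2 * m - 1).doubleFactorial * (b / n) ^ m / b ^ m)) := by gcongr
    _ = _ := by
      rw [div_pow, div_pow, div_pow]
      field_simp

/-- The real and imaginary parts of `∑ k, u_k c_k` are linear forms in `u`. -/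
lemma norm_sq_sum_ofReal_mul {n : ℕ} (c : Fin n → ℂ) (u : EuclideanSpace ℝ (Fin n)) :
    ‖∑ k, (u k : ℂ) * c k‖ ^ 2 = inner ℝ u (WithLp.toLp 2 fun k => (c k).re) ^ 2 +
      inner ℝ u (WithLp.toLp 2 fun k => (c k).im) ^ 2 := by
  rw [← Complex.normSq_eq_norm_sq, Complex.normSq_apply]
  simp [PiLp.inner_apply, sq, mul_comm]

lemma norm_sq_re_add_norm_sq_im {n : ℕ} (c : Fin n → ℂ) :
    ‖(WithLp.toLp 2 fun k => (c k).re : EuclideanSpace ℝ (Fin n))‖ ^ 2 +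
      ‖(WithLp.toLp 2 fun k => (c k).im : EuclideanSpace ℝ (Fin n))‖ ^ 2 = ∑ k, ‖c k‖ ^ 2 := by
  simp only [EuclideanSpace.norm_sq_eq, Real.norm_eq_abs, sq_abs, ← Finset.sum_add_distrib]
  refine Finset.sum_congr rfl fun k _ => ?_
  rw [← Complex.normSq_eq_norm_sq, Complex.normSq_apply]
  ring

/-- Second moment of a random complex linear combination. -/
lemma integral_norm_sum_sq_sphereProb (n : ℕ) [NeZero n] (c : Fin n → ℂ) :
    ∫ u, ‖∑ k, ((u : EuclideanSpace ℝ (Fin n)) k : ℂ) * c k‖ ^ 2 ∂(sphereProb n)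
      = (∑ k, ‖c k‖ ^ 2) / n := by
  simp_rw [norm_sq_sum_ofReal_mul]
  rw [integral_add (Continuous.integrable_sphereProb (by fun_prop))
    (Continuous.integrable_sphereProb (by fun_prop)), integral_inner_sq_sphereProb,
    integral_inner_sq_sphereProb, ← add_div, norm_sq_re_add_norm_sq_im]

/-- Higher even moments of a random complex linear combination. For `m = 2` the constant is `3`. -/
lemma integral_norm_sum_pow_sphereProb_le (n m : ℕ) [NeZero n] (c : Fin n → ℂ) :
    ∫ u, ‖∑ k, ((u : EuclideanSpace ℝ (Fin n)) k : ℂ) * c k‖ ^ (2 * m) ∂(sphereProb n)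
      ≤ (2 * m - 1).doubleFactorial * ((∑ k, ‖c k‖ ^ 2) / n) ^ m := by
  simp_rw [pow_mul, norm_sq_sum_ofReal_mul]
  rw [← norm_sq_re_add_norm_sq_im]
  exact integral_inner_pair_pow_sphereProb_le n m _ _

/-- A lower bound for the first absolute moment by the second one. It follows from
`E|F|² = V`, `E|F|⁴ ≤ 3 V²` and the pointwise inequality `t ≥ (3/4) t² - (1/16) t⁴` for `t ≥ 0`. -/
lemma le_integral_norm_sum_sphereProb (n : ℕ) [NeZero n] (c : Fin n → ℂ) :
    √((∑ k, ‖c k‖ ^ 2) / n) / 2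
      ≤ ∫ u, ‖∑ k, ((u : EuclideanSpace ℝ (Fin n)) k : ℂ) * c k‖ ∂(sphereProb n) := by
  have hn : (0 : ℝ) < n := by exact_mod_cast Nat.pos_of_ne_zero (NeZero.ne n)
  set V := (∑ k, ‖c k‖ ^ 2) / n with hVdef
  have hV0 : 0 ≤ V := by positivity
  rcases hV0.eq_or_lt with hV | hV
  · rw [← hV]
    simpa using integral_nonneg fun u => norm_nonneg _
  set r := √V with hr
  have hr0 : 0 < r := Real.sqrt_pos.2 hV
  have hrV : r ^ 2 = V := Real.sq_sqrt hV0
  have hpt (t : ℝ) (ht : 0 ≤ t) : 3 / 4 / r * t ^ 2 - 1 / 16 / r ^ 3 * t ^ (2 * 2) ≤ t := by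
    have h : 0 ≤ t * ((t / r - 2) ^ 2 * (t / r + 4)) / 16 := by positivity
    have h2 : t * ((t / r - 2) ^ 2 * (t / r + 4)) / 16
        = t - (3 / 4 / r * t ^ 2 - 1 / 16 / r ^ 3 * t ^ (2 * 2)) := by
      field_simp
      ring
    linarith
  have h2 := integral_norm_sum_sq_sphereProb n c
  have h4 := integral_norm_sum_pow_sphereProb_le n 2 c
  rw [← hVdef] at h2 h4
  have h5 := integral_mono (μ := sphereProb n)
    (f := fun u => 3 / 4 / r * ‖∑ k, ((u : EuclideanSpace ℝ (Fin n)) k : ℂ) * c k‖ ^ 2 -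
      1 / 16 / r ^ 3 * ‖∑ k, ((u : EuclideanSpace ℝ (Fin n)) k : ℂ) * c k‖ ^ (2 * 2))
    (Continuous.integrable_sphereProb (by fun_prop))
    (Continuous.integrable_sphereProb (by fun_prop)) fun u => hpt _ (norm_nonneg _)
  refine le_trans ?_ h5
  rw [integral_sub (Continuous.integrable_sphereProb (by fun_prop))
    (Continuous.integrable_sphereProb (by fun_prop)), integral_const_mul, integral_const_mul, h2]
  calc r / 2 ≤ 3 / 4 / r * r ^ 2 - 1 / 16 / r ^ 3 * (3 * (r ^ 2) ^ 2) := by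
        have : 3 / 4 / r * r ^ 2 - 1 / 16 / r ^ 3 * (3 * (r ^ 2) ^ 2) = 9 / 16 * r := by
          field_simp
          ring
        linarith
    _ ≤ _ := by
      rw [hrV]
      gcongr
      simpa [Nat.doubleFactorial] using h4

/-! ### Unitary substitutions in polynomials -/

lemma MvPolynomial.IsWeightedHomogeneous.aeval_of_weights {R σ τ M : Type*} [CommSemiring R]
    [AddCommMonoid M] {w : σ → M} {w' : τ → M} {p : MvPolynomial σ R} {m : M}
    (hp : p.IsWeightedHomogeneous w m) {g : σ → MvPolynomial τ R}
    (hg : ∀ i, (g i).IsWeightedHomogeneous w' (w i)) :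
    (MvPolynomial.aeval g p).IsWeightedHomogeneous w' m := by
  rw [MvPolynomial.aeval_def, MvPolynomial.eval₂_eq]
  refine (MvPolynomial.weightedHomogeneousSubmodule R w' m).sum_mem fun e he => ?_
  rw [MvPolynomial.mem_weightedHomogeneousSubmodule]
  have h := (MvPolynomial.isWeightedHomogeneous_C w' (p.coeff e)).mul
    (MvPolynomial.IsWeightedHomogeneous.prod e.support _ _ fun i _ => (hg i).pow (e i))
  rw [zero_add] at h
  rw [← hp (MvPolynomial.mem_support_iff.1 he), Finsupp.weight_apply]
  exact h

lemma MvPolynomial.totalDegree_aeval_le_of_forall_le_one {R σ τ : Type*} [CommSemiring R]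
    (p : MvPolynomial σ R) {g : σ → MvPolynomial τ R} (hg : ∀ i, (g i).totalDegree ≤ 1) :
    (MvPolynomial.aeval g p).totalDegree ≤ p.totalDegree := by
  rw [MvPolynomial.aeval_def, MvPolynomial.eval₂_eq]
  refine MvPolynomial.totalDegree_finsetSum_le fun e he => ?_
  refine (MvPolynomial.totalDegree_mul _ _).trans ?_
  rw [MvPolynomial.algebraMap_eq, MvPolynomial.totalDegree_C, zero_add]
  refine (MvPolynomial.totalDegree_finsetProd _ _).trans ?_
  refine le_trans (Finset.sum_le_sum fun i _ => ?_) (MvPolynomial.le_totalDegree he)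
  refine (MvPolynomial.totalDegree_pow _ _).trans ?_
  simpa using Nat.mul_le_mul_left (e i) (hg i)

section UnitarySubstitution

variable {d : ℕ}

/-- The matrix of a unitary map in the standard basis. -/
noncomputable def unitaryMatrix (U : EuclideanSpace ℂ (Fin d) ≃ₗᵢ[ℂ] EuclideanSpace ℂ (Fin d)) :
    Matrix (Fin d) (Fin d) ℂ :=
  fun i j => U (EuclideanSpace.single j 1) i

lemma unitary_apply (U : EuclideanSpace ℂ (Fin d) ≃ₗᵢ[ℂ] EuclideanSpace ℂ (Fin d))
    (z : EuclideanSpace ℂ (Fin d)) (i : Fin d) :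
    U z i = ∑ j, unitaryMatrix U i j * z j := by
  conv_lhs => rw [← (EuclideanSpace.basisFun (Fin d) ℂ).sum_repr z]
  simp [unitaryMatrix, mul_comm]

lemma sum_unitaryMatrix_mul_conj
    (U : EuclideanSpace ℂ (Fin d) ≃ₗᵢ[ℂ] EuclideanSpace ℂ (Fin d)) (i i' : Fin d) :
    ∑ j, unitaryMatrix U i j * conj (unitaryMatrix U i' j) = if i = i' then 1 else 0 := by
  have h : (unitaryMatrix U).conjTranspose * unitaryMatrix U = 1 := by
    ext j j'
    have h := U.inner_map_map (EuclideanSpace.single j (1 : ℂ)) (EuclideanSpace.single j' 1)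
    rw [PiLp.inner_apply] at h
    simp only [EuclideanSpace.inner_single_left, RCLike.inner_apply, map_one, one_mul] at h
    simp only [Matrix.mul_apply, Matrix.conjTranspose_apply, unitaryMatrix, Matrix.one_apply]
    rw [Finset.sum_congr rfl fun x _ => mul_comm _ _]
    simpa [Pi.single_apply] using h
  have h' := congrArg (fun M : Matrix (Fin d) (Fin d) ℂ => M i i') (mul_eq_one_comm.1 h)
  simpa [Matrix.mul_apply, Matrix.one_apply] using h'

/-- The images of the variables under the substitution `z ↦ U z` in polynomials in
`z` and `conj z`. -/
noncomputable def unitaryVar (U : EuclideanSpace ℂ (Fin d) ≃ₗᵢ[ℂ] EuclideanSpace ℂ (Fin d)) :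
    Fin d ⊕ Fin d → ZPoly d :=
  Sum.elim (fun i => ∑ j, MvPolynomial.C (unitaryMatrix U i j) * MvPolynomial.X (Sum.inl j))
    (fun i => ∑ j, MvPolynomial.C (conj (unitaryMatrix U i j)) * MvPolynomial.X (Sum.inr j))

lemma restrictToSphere_apply (p : ZPoly d) (z : CSphere d) :
    restrictToSphere d p z = MvPolynomial.aeval (R := ℂ)
      (Sum.elim (fun j => z.1 j) (fun j => conj (z.1 j)) : Fin d ⊕ Fin d → ℂ) p := rfl

lemma restrictToSphere_aeval_unitaryVar
    (U : EuclideanSpace ℂ (Fin d) ≃ₗᵢ[ℂ] EuclideanSpace ℂ (Fin d)) (p : ZPoly d) (z : CSphere d) :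
    restrictToSphere d (MvPolynomial.aeval (unitaryVar U) p) z =
      restrictToSphere d p (sphereRotation U z) := by
  rw [restrictToSphere_apply, restrictToSphere_apply, ← AlgHom.comp_apply,
    MvPolynomial.comp_aeval]
  congr 2
  ext i
  rcases i with i | i
  · simp [unitaryVar, unitary_apply]
  · simp [unitaryVar, unitary_apply]

lemma isWeightedHomogeneous_unitaryVar
    (U : EuclideanSpace ℂ (Fin d) ≃ₗᵢ[ℂ] EuclideanSpace ℂ (Fin d)) (i : Fin d ⊕ Fin d) :
    (unitaryVar U i).IsWeightedHomogeneous (bidegreeWeight d) (bidegreeWeight d i) := by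
  rcases i with i | i <;> simp only [unitaryVar, Sum.elim_inl, Sum.elim_inr] <;>
  · refine (MvPolynomial.weightedHomogeneousSubmodule ℂ (bidegreeWeight d) _).sum_mem
      fun j _ => ?_
    rw [MvPolynomial.mem_weightedHomogeneousSubmodule]
    convert (MvPolynomial.isWeightedHomogeneous_C (bidegreeWeight d) _).mul
      (MvPolynomial.isWeightedHomogeneous_X ℂ (bidegreeWeight d) _) using 1
    exact (zero_add _).symm

lemma totalDegree_unitaryVar_le
    (U : EuclideanSpace ℂ (Fin d) ≃ₗᵢ[ℂ] EuclideanSpace ℂ (Fin d)) (i : Fin d ⊕ Fin d) :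
    (unitaryVar U i).totalDegree ≤ 1 := by
  rcases i with i | i <;> simp only [unitaryVar, Sum.elim_inl, Sum.elim_inr] <;>
  · refine MvPolynomial.totalDegree_finsetSum_le fun j _ => ?_
    refine (MvPolynomial.totalDegree_mul _ _).trans ?_
    simp

/-- The chain rule for substitutions in polynomials. -/
lemma pderiv_aeval {R σ τ : Type*} [CommRing R] [Fintype σ] (g : σ → MvPolynomial τ R)
    (p : MvPolynomial σ R) (j : τ) :
    MvPolynomial.pderiv j (MvPolynomial.aeval g p) =
      ∑ i, MvPolynomial.aeval g (MvPolynomial.pderiv i p) * MvPolynomial.pderiv j (g i) := by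
  classical
  induction p using MvPolynomial.induction_on with
  | C a => simp
  | add p q hp hq => simp only [map_add, hp, hq, add_mul, Finset.sum_add_distrib]
  | mul_X p k hp =>
    simp only [map_mul, Derivation.leibniz, MvPolynomial.aeval_X, hp, smul_eq_mul, map_add,
      MvPolynomial.pderiv_X, add_mul, Finset.sum_add_distrib, Finset.mul_sum]
    congr 1
    · rw [Finset.sum_eq_single k]
      · simp
      · intro i _ hi
        simp [hi.symm]
      · simp
    · exact Finset.sum_congr rfl fun i _ => by ring

lemma complexLaplacian_apply (p : ZPoly d) :
    complexLaplacian d p = (4 : ℂ) • ∑ j : Fin d,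
      MvPolynomial.pderiv (Sum.inl j) (MvPolynomial.pderiv (Sum.inr j) p) := by
  simp [complexLaplacian]

lemma pderiv_inl_aeval_unitaryVar
    (U : EuclideanSpace ℂ (Fin d) ≃ₗᵢ[ℂ] EuclideanSpace ℂ (Fin d)) (p : ZPoly d) (j : Fin d) :
    MvPolynomial.pderiv (Sum.inl j) (MvPolynomial.aeval (unitaryVar U) p) =
      ∑ i, unitaryMatrix U i j •
        MvPolynomial.aeval (unitaryVar U) (MvPolynomial.pderiv (Sum.inl i) p) := by
  rw [pderiv_aeval, Fintype.sum_sum_type]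
  simp [unitaryVar, Pi.single_apply, MvPolynomial.smul_eq_C_mul, mul_comm]

lemma pderiv_inr_aeval_unitaryVar
    (U : EuclideanSpace ℂ (Fin d) ≃ₗᵢ[ℂ] EuclideanSpace ℂ (Fin d)) (p : ZPoly d) (j : Fin d) :
    MvPolynomial.pderiv (Sum.inr j) (MvPolynomial.aeval (unitaryVar U) p) =
      ∑ i, conj (unitaryMatrix U i j) •
        MvPolynomial.aeval (unitaryVar U) (MvPolynomial.pderiv (Sum.inr i) p) := by
  rw [pderiv_aeval, Fintype.sum_sum_type]
  simp [unitaryVar, Pi.single_apply, MvPolynomial.smul_eq_C_mul, mul_comm]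

/-- The Laplacian commutes with unitary changes of variables. -/
lemma complexLaplacian_aeval_unitaryVar
    (U : EuclideanSpace ℂ (Fin d) ≃ₗᵢ[ℂ] EuclideanSpace ℂ (Fin d)) (p : ZPoly d) :
    complexLaplacian d (MvPolynomial.aeval (unitaryVar U) p) =
      MvPolynomial.aeval (unitaryVar U) (complexLaplacian d p) := by
  simp only [complexLaplacian_apply, map_smul, map_sum, pderiv_inr_aeval_unitaryVar,
    Derivation.map_smul, pderiv_inl_aeval_unitaryVar]
  congr 1
  simp only [Finset.smul_sum]
  rw [Finset.sum_comm]
  refine Finset.sum_congr rfl fun i _ => ?_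
  rw [Finset.sum_comm]
  simp_rw [smul_smul, ← Finset.sum_smul]
  simp_rw [mul_comm (conj _), sum_unitaryMatrix_mul_conj]
  simp

/-- A space of functions on the sphere is rotation invariant if it is closed under composition
with unitary maps. -/
def IsRotationInvariant (V : Submodule ℂ (CSphere d → ℂ)) : Prop :=
  ∀ (U : EuclideanSpace ℂ (Fin d) ≃ₗᵢ[ℂ] EuclideanSpace ℂ (Fin d)), ∀ f ∈ V,
    f ∘ sphereRotation U ∈ V

lemma isRotationInvariant_map {P : Submodule ℂ (ZPoly d)}
    (hP : ∀ (U : EuclideanSpace ℂ (Fin d) ≃ₗᵢ[ℂ] EuclideanSpace ℂ (Fin d)), ∀ p ∈ P,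
      MvPolynomial.aeval (unitaryVar U) p ∈ P) :
    IsRotationInvariant (P.map (restrictToSphere d)) := by
  rintro U _ ⟨p, hp, rfl⟩
  exact ⟨_, hP U p hp, funext fun z => restrictToSphere_aeval_unitaryVar U p z⟩

lemma isRotationInvariant_iSup {ι : Sort*} {V : ι → Submodule ℂ (CSphere d → ℂ)}
    (hV : ∀ i, IsRotationInvariant (V i)) : IsRotationInvariant (⨆ i, V i) := by
  intro U
  have h : ⨆ i, V i ≤ (⨆ i, V i).comap (LinearMap.funLeft ℂ ℂ (sphereRotation U)) :=
    iSup_le fun i f hf => le_iSup V i (hV i U f hf)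
  exact h

lemma isRotationInvariant_sphericalHarmonics (m n : ℕ) :
    IsRotationInvariant (sphericalHarmonics d m n) := by
  refine isRotationInvariant_map fun U p hp => ⟨?_, ?_⟩
  · exact MvPolynomial.IsWeightedHomogeneous.aeval_of_weights hp.1
      (isWeightedHomogeneous_unitaryVar U)
  · have h := LinearMap.mem_ker.1 hp.2
    exact LinearMap.mem_ker.2 (by rw [complexLaplacian_aeval_unitaryVar, h, map_zero])

lemma isRotationInvariant_shell (l : ℕ) : IsRotationInvariant (shell d l) :=
  isRotationInvariant_iSup fun m => isRotationInvariant_iSup fun n =>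
    isRotationInvariant_iSup fun _ => isRotationInvariant_sphericalHarmonics m n

end UnitarySubstitution

/-! ### Orthonormal families on the complex sphere -/

section OrthonormalFamilies

variable {d : ℕ} {c : ℝ≥0}

instance isFiniteMeasure_sphereMeasure (d : ℕ) (c : ℝ≥0) :
    IsFiniteMeasure (sphereMeasure d c) := by
  unfold sphereMeasure
  infer_instance

lemma isOpenPosMeasure_sphereMeasure (hc : 0 < c) : (sphereMeasure d c).IsOpenPosMeasure := by
  refine ⟨fun U hU hne => ?_⟩
  rw [sphereMeasure, Measure.smul_apply, ENNReal.smul_def, smul_eq_mul]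
  exact mul_ne_zero (by exact_mod_cast hc.ne') (hU.measure_ne_zero _ hne)

lemma sphereMass_pos (hd : 0 < d) (hc : 0 < c) : 0 < sphereMass d c := by
  have := isOpenPosMeasure_sphereMeasure (d := d) hc
  have : Nonempty (Fin d) := ⟨⟨0, hd⟩⟩
  obtain ⟨e, he⟩ := exists_norm_eq (EuclideanSpace ℂ (Fin d)) zero_le_one
  have : Nonempty (CSphere d) := ⟨⟨e, by simp [he]⟩⟩
  exact ENNReal.toReal_pos (isOpen_univ.measure_ne_zero _ Set.univ_nonempty) (measure_ne_top _ _)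

/-- Continuous functions on the sphere are integrable. -/
lemma Continuous.integrable_sphereMeasure {E : Type*} [NormedAddCommGroup E] {f : CSphere d → E}
    (hf : Continuous f) : Integrable f (sphereMeasure d c) :=
  hf.integrable_of_hasCompactSupport (HasCompactSupport.of_compactSpace f)

lemma integral_sphereMeasure_rotation
    (U : EuclideanSpace ℂ (Fin d) ≃ₗᵢ[ℂ] EuclideanSpace ℂ (Fin d)) {f : CSphere d → ℂ}
    (hf : Continuous f) :
    ∫ z, f (sphereRotation U z) ∂(sphereMeasure d c) = ∫ z, f z ∂(sphereMeasure d c) := by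
  have h := measurePreserving_sphereRotation U (measurePreserving_unitary U)
  unfold sphereMeasure
  rw [integral_smul_nnreal_measure, integral_smul_nnreal_measure]
  conv_rhs => rw [← h.map_eq]
  rw [integral_map h.measurable.aemeasurable hf.aestronglyMeasurable]

/-- A finite family of continuous functions on the sphere that is orthonormal in
`L²(sphereMeasure d c)`. -/
structure IsOrthonormalFamily {ι : Type*} [DecidableEq ι] (c : ℝ≥0) (f : ι → CSphere d → ℂ) :
    Prop where
  continuous : ∀ k, Continuous (f k)
  integral_mul_conj : ∀ j k,
    ∫ z, f j z * conj (f k z) ∂(sphereMeasure d c) = if j = k then 1 else 0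

variable {ι : Type*} [Fintype ι] [DecidableEq ι] {f : ι → CSphere d → ℂ}

lemma IsOrthonormalFamily.integral_sum_mul_conj_sum (hf : IsOrthonormalFamily c f) (a b : ι → ℂ) :
    ∫ z, (∑ j, a j * f j z) * conj (∑ j, b j * f j z) ∂(sphereMeasure d c)
      = ∑ j, a j * conj (b j) := by
  have hfc := hf.continuous
  have h : ∀ z, (∑ j, a j * f j z) * conj (∑ j, b j * f j z)
      = ∑ j, ∑ k, a j * conj (b k) * (f j z * conj (f k z)) := by
    intro z
    rw [map_sum, Finset.sum_mul_sum]
    refine Finset.sum_congr rfl fun j _ => Finset.sum_congr rfl fun k _ => ?_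
    rw [map_mul]
    ring
  simp_rw [h]
  rw [integral_finsetSum _ fun j _ => Continuous.integrable_sphereMeasure (by fun_prop)]
  refine Finset.sum_congr rfl fun j _ => ?_
  rw [integral_finsetSum _ fun k _ => Continuous.integrable_sphereMeasure (by fun_prop)]
  simp_rw [integral_const_mul, hf.integral_mul_conj]
  simp

lemma IsOrthonormalFamily.integral_norm_sum_sq (hf : IsOrthonormalFamily c f) (a : ι → ℂ) :
    ∫ z, ‖∑ j, a j * f j z‖ ^ 2 ∂(sphereMeasure d c) = ∑ j, ‖a j‖ ^ 2 := by
  have h := hf.integral_sum_mul_conj_sum a a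
  simp_rw [RCLike.mul_conj] at h
  apply Complex.ofReal_injective
  rw [← integral_complex_ofReal]
  push_cast
  exact h

lemma IsOrthonormalFamily.linearIndependent (hf : IsOrthonormalFamily c f) :
    LinearIndependent ℂ f := by
  rw [Fintype.linearIndependent_iff]
  intro g hg k
  have h := hf.integral_norm_sum_sq g
  have h0 : ∀ z, ∑ j, g j * f j z = 0 := fun z => by simpa using congrFun hg z
  simp_rw [h0] at h
  simp only [norm_zero, ne_eq, OfNat.ofNat_ne_zero, not_false_eq_true, zero_pow,
    integral_zero] at h
  have h2 := (Finset.sum_eq_zero_iff_of_nonneg fun j _ => by positivity).1 h.symm k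
    (Finset.mem_univ k)
  simpa using h2

/-- If the span of an orthonormal family is rotation invariant, a rotation acts on the family by
a unitary matrix; so `∑ k, |f_k|²` is a rotation invariant function. -/
lemma IsOrthonormalFamily.sum_norm_sq_rotation (hf : IsOrthonormalFamily c f)
    (hspan : IsRotationInvariant (Submodule.span ℂ (Set.range f)))
    (U : EuclideanSpace ℂ (Fin d) ≃ₗᵢ[ℂ] EuclideanSpace ℂ (Fin d)) (z : CSphere d) :
    ∑ k, ‖f k (sphereRotation U z)‖ ^ 2 = ∑ k, ‖f k z‖ ^ 2 := by
  have hfc := hf.continuous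
  have hex : ∀ k, ∃ a : ι → ℂ, ∑ j, a j • f j = f k ∘ sphereRotation U := fun k =>
    (Submodule.mem_span_range_iff_exists_fun ℂ).1
      (hspan U _ (Submodule.subset_span (Set.mem_range_self k)))
  choose a ha using hex
  have ha' : ∀ k z, f k (sphereRotation U z) = ∑ j, a k j * f j z := fun k z => by
    simpa using (congrFun (ha k) z).symm
  let A : Matrix ι ι ℂ := Matrix.of a
  have hA : A * A.conjTranspose = 1 := by
    ext k k'
    have h := integral_sphereMeasure_rotation (c := c) U (f := fun z => f k z * conj (f k' z))
      (by fun_prop)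
    simp_rw [ha', hf.integral_sum_mul_conj_sum, hf.integral_mul_conj] at h
    simpa [Matrix.mul_apply, Matrix.one_apply, A] using h
  rw [mul_eq_one_comm] at hA
  have hv : ∀ v : ι → ℂ, ((∑ k, ‖v k‖ ^ 2 : ℝ) : ℂ) = star v ⬝ᵥ v := fun v => by
    simp [dotProduct, RCLike.conj_mul]
  apply Complex.ofReal_injective
  rw [hv fun k => f k (sphereRotation U z), hv fun k => f k z]
  have hmul : (fun k => f k (sphereRotation U z)) = A.mulVec fun k => f k z := by
    ext k
    rw [ha']
    rfl
  rw [hmul, Matrix.star_mulVec, Matrix.dotProduct_mulVec, Matrix.vecMul_vecMul, hA,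
    Matrix.vecMul_one]

/-- The addition formula on the diagonal: if the span of an orthonormal family is rotation
invariant, then `∑ k, |f_k|²` is constant, with integral the number of functions. -/
lemma IsOrthonormalFamily.sum_norm_sq (hf : IsOrthonormalFamily c f)
    (hspan : IsRotationInvariant (Submodule.span ℂ (Set.range f))) (z : CSphere d) :
    (∑ k, ‖f k z‖ ^ 2) * sphereMass d c = Fintype.card ι := by
  have hfc := hf.continuous
  have hconst : ∀ w : CSphere d, ∑ k, ‖f k w‖ ^ 2 = ∑ k, ‖f k z‖ ^ 2 := by
    intro w
    obtain ⟨U, hU⟩ := exists_linearIsometryEquiv_apply_eq (𝕜 := ℂ) (x := z.1) (y := w.1)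
      (by simp)
    rw [← hf.sum_norm_sq_rotation hspan U z]
    have : sphereRotation U z = w := by ext1; exact hU
    rw [this]
  have h1 : ∫ w, ∑ k, ‖f k w‖ ^ 2 ∂(sphereMeasure d c) = Fintype.card ι := by
    rw [integral_finsetSum _ fun k _ => Continuous.integrable_sphereMeasure (by fun_prop)]
    have h2 : ∀ k, ∫ w, ‖f k w‖ ^ 2 ∂(sphereMeasure d c) = 1 := fun k => by
      simpa [Pi.single_apply, apply_ite norm, ite_pow] using hf.integral_norm_sum_sq (Pi.single k 1)
    simp [h2]
  simp_rw [hconst] at h1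
  rw [integral_const, smul_eq_mul, mul_comm] at h1
  exact h1

end OrthonormalFamilies

/-! ### Polynomial spaces and the Nikolskii inequality -/

section PolynomialSpaces

variable {d : ℕ} {c : ℝ≥0}

/-- A finite-dimensional space of continuous functions on the sphere has an orthonormal basis in
`L²(sphereMeasure d c)`. -/
lemma exists_isOrthonormalFamily (hc : 0 < c) (V : Submodule ℂ (CSphere d → ℂ))
    [FiniteDimensional ℂ V] (hV : ∀ f ∈ V, Continuous f) :
    ∃ f : Fin (Module.finrank ℂ V) → CSphere d → ℂ,
      IsOrthonormalFamily c f ∧ Submodule.span ℂ (Set.range f) = V := by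
  have hpos := isOpenPosMeasure_sphereMeasure (d := d) hc
  have hVc : ∀ f : V, Continuous f.1 := fun f => hV _ f.2
  let core : InnerProductSpace.Core ℂ V :=
    { inner := fun f g => ∫ z, conj (f.1 z) * g.1 z ∂(sphereMeasure d c)
      conj_inner_symm := fun f g => by
        rw [← integral_conj]
        simp [mul_comm]
      re_inner_nonneg := fun f => by
        simp_rw [RCLike.conj_mul]
        norm_cast
        exact integral_nonneg fun z => by positivity
      add_left := fun f g h => by
        have := hVc f
        have := hVc g
        have := hVc h
        rw [← integral_add (Continuous.integrable_sphereMeasure (by fun_prop))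
          (Continuous.integrable_sphereMeasure (by fun_prop))]
        simp [add_mul]
      smul_left := fun f g r => by
        rw [← integral_const_mul]
        simp [mul_assoc]
      definite := fun f h => by
        have hf := hVc f
        simp_rw [RCLike.conj_mul] at h
        norm_cast at h
        rw [RCLike.ofReal_eq_zero, integral_eq_zero_iff_of_nonneg (fun z => by positivity)
            (Continuous.integrable_sphereMeasure (by fun_prop)),
          Continuous.ae_eq_iff_eq _ (by fun_prop) (by fun_prop)] at h
        ext z
        simpa using congrFun h z }
  let : NormedAddCommGroup V := core.toNormedAddCommGroup
  let : InnerProductSpace ℂ V := InnerProductSpace.ofCore core.toCore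
  let b := stdOrthonormalBasis ℂ V
  refine ⟨fun k => (b k).1, ⟨fun k => hVc _, fun j k => ?_⟩, ?_⟩
  · have h := orthonormal_iff_ite.1 b.orthonormal k j
    have h' : ∫ z, conj ((b k).1 z) * (b j).1 z ∂(sphereMeasure d c) = if k = j then 1 else 0 := h
    simp_rw [mul_comm (conj _), eq_comm (a := k)] at h'
    exact h'
  · have h := b.toBasis.span_eq
    have h2 := congrArg (Submodule.map V.subtype) h
    rw [Submodule.map_span, Submodule.map_top, Submodule.range_subtype, ← Set.range_comp] at h2
    refine Eq.trans ?_ h2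
    simp [Function.comp_def]

/-- In a rotation invariant space of dimension `D`, the evaluation functionals have norm
`(D / mass)^{1/2}` for the `L²` norm. -/
lemma norm_sq_le_finrank_mul_integral (hc : 0 < c) {V : Submodule ℂ (CSphere d → ℂ)}
    [FiniteDimensional ℂ V] (hV : ∀ f ∈ V, Continuous f) (hinv : IsRotationInvariant V)
    {g : CSphere d → ℂ} (hg : g ∈ V) (z : CSphere d) :
    ‖g z‖ ^ 2 * sphereMass d c
      ≤ Module.finrank ℂ V * ∫ w, ‖g w‖ ^ 2 ∂(sphereMeasure d c) := by
  obtain ⟨f, hf, hspan⟩ := exists_isOrthonormalFamily hc V hV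
  rw [← hspan] at hg hinv
  obtain ⟨a, rfl⟩ := (Submodule.mem_span_range_iff_exists_fun ℂ).1 hg
  have hsum : ∀ w, (∑ j, a j • f j) w = ∑ j, a j * f j w := fun w => by simp
  simp_rw [hsum]
  rw [hf.integral_norm_sum_sq]
  have h1 := hf.sum_norm_sq hinv z
  rw [Fintype.card_fin] at h1
  rw [← h1, mul_right_comm]
  refine mul_le_mul_of_nonneg_right ?_ ENNReal.toReal_nonneg
  calc ‖∑ j, a j * f j z‖ ^ 2 ≤ (∑ j, ‖a j‖ * ‖f j z‖) ^ 2 := by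
        gcongr
        exact (norm_sum_le _ _).trans (le_of_eq (by simp))
    _ ≤ (∑ j, ‖a j‖ ^ 2) * ∑ j, ‖f j z‖ ^ 2 := Finset.sum_mul_sq_le_sq_mul_sq _ _ _
    _ = _ := mul_comm _ _

lemma continuous_restrictToSphere (p : ZPoly d) : Continuous (restrictToSphere d p) := by
  induction p using MvPolynomial.induction_on with
  | C a =>
    have : restrictToSphere d (MvPolynomial.C a) = fun _ => a := by
      ext z; simp [restrictToSphere_apply]
    rw [this]
    fun_prop
  | add p q hp hq => rw [map_add]; exact hp.add hq
  | mul_X p i hp =>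
    have : restrictToSphere d (p * MvPolynomial.X i) = fun z => restrictToSphere d p z *
        (Sum.elim (fun j => z.1 j) (fun j => conj (z.1 j)) : Fin d ⊕ Fin d → ℂ) i := by
      ext z; simp [restrictToSphere_apply]
    rw [this]
    rcases i with i | i <;> simp only [Sum.elim_inl, Sum.elim_inr] <;> fun_prop

/-- The space of restrictions to the sphere of polynomials in `z` and `conj z` of total degree at
most `N`. -/
noncomputable def spherePolys (d N : ℕ) : Submodule ℂ (CSphere d → ℂ) :=
  (MvPolynomial.restrictTotalDegree (Fin d ⊕ Fin d) ℂ N).map (restrictToSphere d)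

lemma continuous_of_mem_spherePolys {N : ℕ} {f : CSphere d → ℂ} (hf : f ∈ spherePolys d N) :
    Continuous f := by
  obtain ⟨p, -, rfl⟩ := hf
  exact continuous_restrictToSphere p

lemma isRotationInvariant_spherePolys (N : ℕ) : IsRotationInvariant (spherePolys d N) := by
  refine isRotationInvariant_map fun U p hp => ?_
  rw [MvPolynomial.mem_restrictTotalDegree] at hp ⊢
  exact (MvPolynomial.totalDegree_aeval_le_of_forall_le_one p (totalDegree_unitaryVar_le U)).trans
    hp

/-- Monomials with all exponents at most `N` span the polynomials of total degree at most `N`. -/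
lemma spherePolys_le_span (d N : ℕ) : spherePolys d N ≤ Submodule.span ℂ (Set.range
    fun e : Fin d ⊕ Fin d → Fin (N + 1) => restrictToSphere d
      (MvPolynomial.monomial (Finsupp.equivFunOnFinite.symm fun i => (e i : ℕ)) 1)) := by
  rintro _ ⟨p, hp, rfl⟩
  have hp' := (MvPolynomial.mem_restrictTotalDegree _ _ _).1 hp
  rw [p.as_sum, map_sum]
  refine Submodule.sum_mem _ fun e he => ?_
  rw [← mul_one (p.coeff e), ← smul_eq_mul, ← MvPolynomial.smul_monomial, map_smul]
  refine Submodule.smul_mem _ _ (Submodule.subset_span ⟨fun i => ⟨e i, ?_⟩, ?_⟩)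
  · have h1 := MvPolynomial.le_totalDegree he
    have h2 : e i ≤ e.sum fun _ n => n := by
      rw [Finsupp.sum_fintype _ _ (by simp)]
      exact Finset.single_le_sum (f := fun i => e i) (by simp) (Finset.mem_univ i)
    omega
  · have : (Finsupp.equivFunOnFinite.symm fun i => e i) = e := by ext; simp
    simp only [this]

instance finiteDimensional_spherePolys (d N : ℕ) : FiniteDimensional ℂ (spherePolys d N) :=
  have := FiniteDimensional.span_of_finite ℂ (Set.finite_range
    fun e : Fin d ⊕ Fin d → Fin (N + 1) => restrictToSphere d
      (MvPolynomial.monomial (Finsupp.equivFunOnFinite.symm fun i => (e i : ℕ)) 1))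
  Submodule.finiteDimensional_of_le (spherePolys_le_span d N)

lemma finrank_spherePolys_le (d N : ℕ) :
    Module.finrank ℂ (spherePolys d N) ≤ (N + 1) ^ (2 * d) := by
  have := FiniteDimensional.span_of_finite ℂ (Set.finite_range
    fun e : Fin d ⊕ Fin d → Fin (N + 1) => restrictToSphere d
      (MvPolynomial.monomial (Finsupp.equivFunOnFinite.symm fun i => (e i : ℕ)) 1))
  refine (Submodule.finrank_mono (spherePolys_le_span d N)).trans ?_
  refine (finrank_range_le_card _).trans (le_of_eq ?_)
  simp [two_mul]

lemma pow_mem_spherePolys {N : ℕ} {f : CSphere d → ℂ} (hf : f ∈ spherePolys d N) (m : ℕ) :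
    (fun z => f z ^ m) ∈ spherePolys d (m * N) := by
  obtain ⟨p, hp, rfl⟩ := hf
  refine ⟨p ^ m, ?_, ?_⟩
  · rw [SetLike.mem_coe, MvPolynomial.mem_restrictTotalDegree] at hp ⊢
    exact (MvPolynomial.totalDegree_pow p m).trans (Nat.mul_le_mul_left m hp)
  · ext z
    simp [restrictToSphere_apply]

lemma sphericalHarmonics_le_spherePolys (d m n : ℕ) :
    sphericalHarmonics d m n ≤ spherePolys d (m + n) := by
  refine Submodule.map_mono fun p hp => ?_
  rw [MvPolynomial.mem_restrictTotalDegree]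
  refine Finset.sup_le fun e he => ?_
  have h := congrArg (fun q : ℕ × ℕ => q.1 + q.2) (hp.1 (MvPolynomial.mem_support_iff.1 he))
  rw [Finsupp.weight_apply, Finsupp.sum_fintype _ _ (by simp), Fintype.sum_sum_type] at h
  rw [Finsupp.sum_fintype _ _ (by simp), Fintype.sum_sum_type]
  simp only [bidegreeWeight, Sum.elim_inl, Prod.smul_mk, smul_eq_mul, mul_one, mul_zero,
    Sum.elim_inr, Prod.fst_add, Prod.fst_sum, Finset.sum_const_zero, add_zero, Prod.snd_add,
    Prod.snd_sum, zero_add] at h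
  exact h.le

lemma shell_le_spherePolys (d l : ℕ) : shell d l ≤ spherePolys d (2 * l) := by
  refine iSup_le fun m => iSup_le fun n => iSup_le fun h => ?_
  refine (sphericalHarmonics_le_spherePolys d m n).trans (Submodule.map_mono fun p hp => ?_)
  rw [MvPolynomial.mem_restrictTotalDegree] at hp ⊢
  have h1 := le_max_left m n
  have h2 := le_max_right m n
  omega

lemma harmonicBand_le_spherePolys (d M₁ M₂ : ℕ) :
    harmonicBand d M₁ M₂ ≤ spherePolys d (2 * M₂) := by
  refine iSup_le fun l => iSup_le fun h => ?_
  refine (shell_le_spherePolys d l).trans (Submodule.map_mono fun p hp => ?_)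
  rw [MvPolynomial.mem_restrictTotalDegree] at hp ⊢
  have := (Finset.mem_Ioc.1 h).2
  omega

/-- Nikolskii inequality. It comes from the bound on evaluation functionals applied to the
polynomial `f ^ m`. -/
lemma norm_pow_mul_sphereMass_le (hc : 0 < c) {N : ℕ} {f : CSphere d → ℂ}
    (hf : f ∈ spherePolys d N) (m : ℕ) (z : CSphere d) :
    ‖f z‖ ^ (2 * m) * sphereMass d c
      ≤ (m * N + 1) ^ (2 * d) * ∫ w, ‖f w‖ ^ (2 * m) ∂(sphereMeasure d c) := by
  have h := norm_sq_le_finrank_mul_integral hc (fun f hf => continuous_of_mem_spherePolys hf)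
    (isRotationInvariant_spherePolys _) (pow_mem_spherePolys hf m) z
  simp_rw [norm_pow, ← pow_mul, mul_comm m 2] at h
  refine h.trans (mul_le_mul_of_nonneg_right ?_ (integral_nonneg fun w => ?_))
  · exact_mod_cast finrank_spherePolys_le d (m * N)
  · positivity

end PolynomialSpaces

/-! ### A lower bound for the dimension of a band -/

section DimensionLowerBound

variable {d : ℕ}

/-- `z_i ^ a * conj (z_j) ^ b` is harmonic if `i ≠ j`. -/
lemma monomial_mem_sphericalHarmonics {i j : Fin d} (hij : i ≠ j) (a b : ℕ) :
    restrictToSphere d (MvPolynomial.X (Sum.inl i) ^ a * MvPolynomial.X (Sum.inr j) ^ b)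
      ∈ sphericalHarmonics d a b := by
  refine ⟨_, ⟨?_, ?_⟩, rfl⟩
  · have h := ((MvPolynomial.isWeightedHomogeneous_X ℂ (bidegreeWeight d) (Sum.inl i)).pow a).mul
      ((MvPolynomial.isWeightedHomogeneous_X ℂ (bidegreeWeight d) (Sum.inr j)).pow b)
    simpa [bidegreeWeight] using h
  · refine LinearMap.mem_ker.2 ?_
    rw [complexLaplacian_apply]
    refine smul_eq_zero_of_right _ (Finset.sum_eq_zero fun k _ => ?_)
    rcases eq_or_ne k j with rfl | hk
    · simp [Derivation.leibniz, Derivation.leibniz_pow, MvPolynomial.pderiv_X, hij.symm]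
    · simp [Derivation.leibniz, Derivation.leibniz_pow, MvPolynomial.pderiv_X, hk.symm]

/-- The functions `z_i ^ a * conj (z_j) ^ M`, `a ≤ M`, are linearly independent: on the points with
`z_i = r`, `z_j = (1 - r²)^{1/2}`, a vanishing combination is a polynomial in `r` with infinitely
many zeros. -/
lemma linearIndependent_monomials {i j : Fin d} (hij : i ≠ j) (M : ℕ) :
    LinearIndependent ℂ fun a : Fin (M + 1) =>
      restrictToSphere d
        (MvPolynomial.X (Sum.inl i) ^ (a : ℕ) * MvPolynomial.X (Sum.inr j) ^ M) := by
  rw [Fintype.linearIndependent_iff]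
  intro g hg
  let P : Polynomial ℂ := ∑ a : Fin (M + 1), Polynomial.monomial (a : ℕ) (g a)
  have hroot : ∀ r ∈ Set.Ioo (0 : ℝ) 1, P.IsRoot (r : ℂ) := by
    rintro r ⟨hr0, hr1⟩
    have hpos : 0 < 1 - r ^ 2 := by nlinarith
    let z : EuclideanSpace ℂ (Fin d) :=
      EuclideanSpace.single i (r : ℂ) + EuclideanSpace.single j ((√(1 - r ^ 2) : ℝ) : ℂ)
    have hz : ‖z‖ = 1 := by
      have hin : inner ℂ (EuclideanSpace.single i (r : ℂ))
          (EuclideanSpace.single j ((√(1 - r ^ 2) : ℝ) : ℂ)) = 0 := by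
        simp [EuclideanSpace.inner_single_left, hij]
      have h := norm_add_sq_eq_norm_sq_add_norm_sq_of_inner_eq_zero _ _ hin
      have h2 : ‖z‖ * ‖z‖ = 1 := by
        rw [h]
        simp only [PiLp.norm_single, Complex.norm_real, Real.norm_eq_abs, abs_mul_abs_self]
        rw [Real.mul_self_sqrt hpos.le]
        ring
      nlinarith [norm_nonneg z]
    have h := congrFun hg ⟨z, by simpa using hz⟩
    have hzi : z i = r := by simp [z, hij]
    have hzj : z j = ((√(1 - r ^ 2) : ℝ) : ℂ) := by simp [z, hij.symm]
    simp only [Finset.sum_apply, Pi.smul_apply, restrictToSphere_apply, map_mul, map_pow,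
      MvPolynomial.aeval_X, Sum.elim_inl, Sum.elim_inr, hzi, hzj, smul_eq_mul, Pi.zero_apply,
      ← mul_assoc, ← Finset.sum_mul] at h
    have hne : (conj ((√(1 - r ^ 2) : ℝ) : ℂ)) ^ M ≠ 0 := by
      rw [Complex.conj_ofReal]
      exact pow_ne_zero _ (by exact_mod_cast (Real.sqrt_pos.2 hpos).ne')
    have h3 := (mul_eq_zero.1 h).resolve_right hne
    simpa [P, Polynomial.IsRoot, Polynomial.eval_finsetSum] using h3
  have hP : P = 0 := Polynomial.eq_zero_of_infinite_isRoot P <|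
    ((Set.Ioo_infinite (zero_lt_one (α := ℝ))).image Complex.ofReal_injective.injOn).mono (by
      rintro _ ⟨r, hr, rfl⟩
      exact hroot r hr)
  intro a
  have h := congrArg (fun Q => Polynomial.coeff Q (a : ℕ)) hP
  simpa [P, Polynomial.finsetSum_coeff, Polynomial.coeff_monomial, Fin.val_inj] using h

instance finiteDimensional_harmonicBand (d M₁ M₂ : ℕ) :
    FiniteDimensional ℂ (harmonicBand d M₁ M₂) :=
  Submodule.finiteDimensional_of_le (harmonicBand_le_spherePolys d M₁ M₂)

lemma lt_bandDim (hd : 2 ≤ d) {M₁ M₂ : ℕ} (hM : M₁ < M₂) : M₂ < bandDim d M₁ M₂ := by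
  have hij : (⟨0, by omega⟩ : Fin d) ≠ ⟨1, by omega⟩ := by simp
  have hle : Submodule.span ℂ (Set.range fun a : Fin (M₂ + 1) =>
      restrictToSphere d (MvPolynomial.X (Sum.inl (⟨0, by omega⟩ : Fin d)) ^ (a : ℕ) *
        MvPolynomial.X (Sum.inr (⟨1, by omega⟩ : Fin d)) ^ M₂)) ≤ harmonicBand d M₁ M₂ := by
    rw [Submodule.span_le]
    rintro _ ⟨a, rfl⟩
    have h1 : shell d M₂ ≤ harmonicBand d M₁ M₂ :=
      le_iSup₂_of_le M₂ (Finset.mem_Ioc.2 ⟨hM, le_rfl⟩) le_rfl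
    have h2 : sphericalHarmonics d a M₂ ≤ shell d M₂ :=
      le_iSup_of_le (a : ℕ) <| le_iSup_of_le M₂ <|
        le_iSup_of_le (max_eq_right (by omega)) le_rfl
    exact h1 (h2 (monomial_mem_sphericalHarmonics hij _ _))
  have h := Submodule.finrank_mono hle
  rw [finrank_span_eq_card (linearIndependent_monomials hij M₂), Fintype.card_fin] at h
  exact h

end DimensionLowerBound

/-! ### Levy means of `L^p` norms -/

section LevyMean

variable {n : ℕ}

lemma levyMean_nonneg (N : EuclideanSpace ℝ (Fin n) → ℝ) : 0 ≤ levyMean N := Real.sqrt_nonneg _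

lemma levyMean_sq [NeZero n] (N : EuclideanSpace ℝ (Fin n) → ℝ) :
    levyMean N ^ 2 = ∫ x, N (x : EuclideanSpace ℝ (Fin n)) ^ 2 ∂(sphereProb n) := by
  rw [levyMean_eq, Real.sq_sqrt (integral_nonneg fun x => by positivity)]

lemma levyMean_le_mul [NeZero n] {N N' : EuclideanSpace ℝ (Fin n) → ℝ} {a : ℝ} (ha : 0 ≤ a)
    (hN : ∀ x, 0 ≤ N x) (hN' : Continuous N') (h : ∀ x, N x ≤ a * N' x) :
    levyMean N ≤ a * levyMean N' := by
  refine le_of_sq_le_sq ?_ (mul_nonneg ha (levyMean_nonneg _))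
  rw [mul_pow, levyMean_sq, levyMean_sq, ← integral_const_mul]
  refine integral_mono_of_nonneg (.of_forall fun x => by positivity)
    (Continuous.integrable_sphereProb (by fun_prop)) (.of_forall fun x => ?_)
  simp only [← mul_pow]
  exact pow_le_pow_left₀ (hN _) (h _) 2

/-- Jensen's inequality for the power `t ↦ t ^ m`. -/
lemma levyMean_pow_le [NeZero n] {N : EuclideanSpace ℝ (Fin n) → ℝ} (hN : Continuous N) (m : ℕ) :
    levyMean N ^ (2 * m) ≤
      ∫ x, N (x : EuclideanSpace ℝ (Fin n)) ^ (2 * m) ∂(sphereProb n) := by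
  have h := (convexOn_pow (𝕜 := ℝ) m).map_integral_le (μ := sphereProb n)
    (f := fun x => N (x : EuclideanSpace ℝ (Fin n)) ^ 2)
    (by fun_prop) isClosed_Ici (.of_forall fun x => Set.mem_Ici.2 (by positivity))
    (Continuous.integrable_sphereProb (by fun_prop))
    (Continuous.integrable_sphereProb (by unfold Function.comp; fun_prop))
  rw [pow_mul, levyMean_sq]
  simpa only [← pow_mul] using h

/-- Jensen's inequality for the square. -/
lemma integral_le_levyMean [NeZero n] {N : EuclideanSpace ℝ (Fin n) → ℝ} (hN : Continuous N) :
    ∫ x, N (x : EuclideanSpace ℝ (Fin n)) ∂(sphereProb n) ≤ levyMean N := by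
  have h := (even_two.convexOn_pow (𝕜 := ℝ)).map_integral_le (μ := sphereProb n)
    (f := fun x => N (x : EuclideanSpace ℝ (Fin n)))
    (by fun_prop) isClosed_univ (.of_forall fun x => Set.mem_univ _)
    (Continuous.integrable_sphereProb (by fun_prop))
    (Continuous.integrable_sphereProb (by unfold Function.comp; fun_prop))
  rw [levyMean_eq]
  exact Real.le_sqrt_of_sq_le h

end LevyMean

section RandomCombinations

variable {d n : ℕ} {c : ℝ≥0} {g : Fin n → CSphere d → ℂ}

/-- The norm `α ↦ ‖∑ k, α_k g_k‖_p` on `ℝ^n`, for functions `g_k` on the sphere. -/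
noncomputable def combNorm (c : ℝ≥0) (g : Fin n → CSphere d → ℂ) (p : ℝ≥0∞)
    (α : EuclideanSpace ℝ (Fin n)) : ℝ :=
  (eLpNorm (coordMap g α) p (sphereMeasure d c)).toReal

lemma combNorm_nonneg (p : ℝ≥0∞) (α : EuclideanSpace ℝ (Fin n)) : 0 ≤ combNorm c g p α :=
  ENNReal.toReal_nonneg

lemma continuous_coordMap (hg : ∀ k, Continuous (g k)) (α : EuclideanSpace ℝ (Fin n)) :
    Continuous (coordMap g α) := by
  unfold coordMap
  fun_prop

lemma Continuous.memLp_sphereMeasure {f : CSphere d → ℂ} (hf : Continuous f) (p : ℝ≥0∞) :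
    MemLp f p (sphereMeasure d c) := by
  obtain ⟨C, hC⟩ := isCompact_univ.exists_bound_of_continuousOn hf.continuousOn
  exact MemLp.of_bound hf.aestronglyMeasurable C (.of_forall fun z => hC z (Set.mem_univ z))

lemma continuous_combNorm (hg : ∀ k, Continuous (g k)) {p : ℝ≥0∞} (hp : 1 ≤ p) :
    Continuous (combNorm c g p) := by
  have : Fact (1 ≤ p) := ⟨hp⟩
  let T := ContinuousMap.toLp (E := ℂ) p (sphereMeasure d c) ℂ
  have h : combNorm c g p = fun α => ‖∑ k, (α k : ℂ) • T ⟨g k, hg k⟩‖ := by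
    ext α
    have h1 : ∑ k, (α k : ℂ) • T ⟨g k, hg k⟩ = T ⟨coordMap g α, continuous_coordMap hg α⟩ := by
      simp_rw [← map_smul, ← map_sum]
      congr 1
      ext z
      simp [coordMap]
    rw [h1, Lp.norm_def, combNorm]
    congr 1
    exact eLpNorm_congr_ae (ContinuousMap.coeFn_toLp (𝕜 := ℂ) (p := p) (sphereMeasure d c)
      ⟨coordMap g α, continuous_coordMap hg α⟩).symm
  rw [h]
  fun_prop

/-- Hölder's inequality. -/
lemma combNorm_le_rpow_mul_combNorm (hg : ∀ k, Continuous (g k)) {p q : ℝ≥0∞} (hpq : p ≤ q)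
    (hp : p ≠ 0) (α : EuclideanSpace ℝ (Fin n)) :
    combNorm c g p α ≤ sphereMass d c ^ (1 / p.toReal - 1 / q.toReal) * combNorm c g q α := by
  have hF := continuous_coordMap hg α
  have h := eLpNorm_le_eLpNorm_mul_rpow_measure_univ (μ := sphereMeasure d c) hpq
    hF.aestronglyMeasurable
  have hle : 0 ≤ 1 / p.toReal - 1 / q.toReal := by
    rcases eq_or_ne q ∞ with rfl | hq
    · simp
    · rw [sub_nonneg]
      exact one_div_le_one_div_of_le (ENNReal.toReal_pos hp (ne_top_of_le_ne_top hq hpq))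
        (ENNReal.toReal_mono hq hpq)
  have h2 := ENNReal.toReal_mono (ENNReal.mul_ne_top (hF.memLp_sphereMeasure q).eLpNorm_ne_top
    (ENNReal.rpow_ne_top_of_nonneg hle (measure_ne_top _ _))) h
  rw [ENNReal.toReal_mul, ← ENNReal.toReal_rpow, mul_comm] at h2
  exact h2

lemma combNorm_pow (hg : ∀ k, Continuous (g k)) {k : ℕ} (hk : k ≠ 0)
    (α : EuclideanSpace ℝ (Fin n)) :
    combNorm c g k α ^ k = ∫ z, ‖coordMap g α z‖ ^ k ∂(sphereMeasure d c) := by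
  have h0 : 0 ≤ ∫ z, ‖coordMap g α z‖ ^ k ∂(sphereMeasure d c) :=
    integral_nonneg fun z => by positivity
  rw [combNorm, ((continuous_coordMap hg α).memLp_sphereMeasure k).eLpNorm_eq_integral_rpow_norm
    (by simpa using hk) (by simp)]
  simp only [ENNReal.toReal_natCast, Real.rpow_natCast]
  rw [ENNReal.toReal_ofReal (by positivity), Real.rpow_inv_natCast_pow h0 hk]

/-- Fubini's theorem for powers of random linear combinations. -/
lemma integral_combNorm_pow [NeZero n] (hg : ∀ k, Continuous (g k)) {k : ℕ} (hk : k ≠ 0) :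
    ∫ u, combNorm c g k (u : EuclideanSpace ℝ (Fin n)) ^ k ∂(sphereProb n)
      = ∫ z, (∫ u, ‖∑ j, ((u : EuclideanSpace ℝ (Fin n)) j : ℂ) * g j z‖ ^ k ∂(sphereProb n))
          ∂(sphereMeasure d c) := by
  simp_rw [combNorm_pow hg hk, coordMap]
  exact integral_integral_swap_of_hasCompactSupport (by unfold Function.uncurry; fun_prop)
    (HasCompactSupport.of_compactSpace _)

lemma levyMean_combNorm_two [NeZero n] (hg : ∀ k, Continuous (g k)) {V : ℝ}
    (hV : ∀ z, (∑ k, ‖g k z‖ ^ 2) / n = V) :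
    levyMean (combNorm c g 2) = √(sphereMass d c * V) := by
  have h := integral_combNorm_pow (c := c) hg two_ne_zero
  simp_rw [integral_norm_sum_sq_sphereProb, hV, integral_const, smul_eq_mul] at h
  rw [levyMean_eq]
  exact congrArg _ h

/-- Jensen's inequality moves the power `2m` inside the Levy mean; Fubini's theorem and the moment
bound on the real sphere do the rest. -/
lemma levyMean_combNorm_even_le [NeZero n] (hg : ∀ k, Continuous (g k)) {V : ℝ}
    (hV : ∀ z, (∑ k, ‖g k z‖ ^ 2) / n = V) (hV0 : 0 ≤ V) {m : ℕ} (hm : m ≠ 0) :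
    levyMean (combNorm c g (2 * m : ℕ)) ≤
      sphereMass d c ^ (1 / (2 * m : ℕ) : ℝ) * √(2 * m) * √V := by
  have hm2 : 2 * m ≠ 0 := by omega
  have hmass : 0 ≤ sphereMass d c := ENNReal.toReal_nonneg
  have h1 := levyMean_pow_le (N := combNorm c g (2 * m : ℕ))
    (continuous_combNorm hg (by exact_mod_cast Nat.one_le_iff_ne_zero.2 hm2)) m
  rw [integral_combNorm_pow hg hm2] at h1
  have h2 : ∫ z, (∫ u, ‖∑ j, ((u : EuclideanSpace ℝ (Fin n)) j : ℂ) * g j z‖ ^ (2 * m)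
      ∂(sphereProb n)) ∂(sphereMeasure d c) ≤ ∫ _, (2 * m) ^ m * V ^ m ∂(sphereMeasure d c) := by
    refine integral_mono_of_nonneg
      (.of_forall fun z => integral_nonneg fun u => by positivity) (integrable_const _)
      (.of_forall fun z => ?_)
    refine (integral_norm_sum_pow_sphereProb_le n m fun j => g j z).trans ?_
    rw [hV]
    refine mul_le_mul_of_nonneg_right ?_ (pow_nonneg hV0 m)
    exact_mod_cast doubleFactorial_le_pow m
  rw [integral_const, smul_eq_mul] at h2
  refine le_of_pow_le_pow_left₀ hm2 (by positivity) (h1.trans (h2.trans (le_of_eq ?_)))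
  have e1 : (sphereMass d c ^ (1 / (2 * m : ℕ) : ℝ)) ^ (2 * m) = sphereMass d c := by
    rw [one_div, Real.rpow_inv_natCast_pow hmass hm2]
  rw [mul_pow _ (√V), mul_pow _ (√(2 * m)), e1, pow_mul, pow_mul (√V),
    Real.sq_sqrt (by positivity), Real.sq_sqrt hV0, mul_assoc]
  rfl

lemma le_levyMean_combNorm_one [NeZero n] (hg : ∀ k, Continuous (g k)) {V : ℝ}
    (hV : ∀ z, (∑ k, ‖g k z‖ ^ 2) / n = V) :
    sphereMass d c * (√V / 2) ≤ levyMean (combNorm c g 1) := by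
  refine le_trans ?_ (integral_le_levyMean (continuous_combNorm hg le_rfl))
  have h := integral_combNorm_pow (c := c) hg one_ne_zero
  simp only [Nat.cast_one, pow_one] at h
  rw [h]
  have h2 : ∫ _, √V / 2 ∂(sphereMeasure d c) = sphereMass d c * (√V / 2) := by
    rw [integral_const, smul_eq_mul]
    rfl
  rw [← h2]
  refine integral_mono (integrable_const _) ?_ fun z => ?_
  · have hint : Integrable (Function.uncurry fun (z : CSphere d)
        (u : Metric.sphere (0 : EuclideanSpace ℝ (Fin n)) 1) =>
        ‖∑ j, ((u : EuclideanSpace ℝ (Fin n)) j : ℂ) * g j z‖)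
        ((sphereMeasure d c).prod (sphereProb n)) :=
      Continuous.integrable_of_hasCompactSupport (by unfold Function.uncurry; fun_prop)
        (HasCompactSupport.of_compactSpace _)
    exact hint.integral_prod_left
  · rw [← hV z]
    exact le_integral_norm_sum_sphereProb n fun j => g j z

/-- Comparison of the supremum norm with an `L^{2m}` norm, from Nikolskii's inequality. -/
lemma combNorm_top_le (hc : 0 < c) (hd : 0 < d) {N : ℕ}
    (hg : ∀ k, g k ∈ spherePolys d N) {m : ℕ} (hm : m ≠ 0) {B : ℝ} (hB : 0 ≤ B)
    (hN : ((m * N + 1 : ℕ) : ℝ) ^ (2 * d) ≤ B ^ (2 * m)) (α : EuclideanSpace ℝ (Fin n)) :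
    combNorm c g ∞ α ≤
      B * sphereMass d c ^ (-(1 / (2 * m : ℕ)) : ℝ) * combNorm c g (2 * m : ℕ) α := by
  have hm2 : 2 * m ≠ 0 := by omega
  have hmass := sphereMass_pos hd hc
  have hgc := fun k => continuous_of_mem_spherePolys (hg k)
  have hF : coordMap g α ∈ spherePolys d N := by
    have : coordMap g α = ∑ k, (α k : ℂ) • g k := by ext z; simp [coordMap]
    rw [this]
    exact Submodule.sum_mem _ fun k _ => Submodule.smul_mem _ _ (hg k)
  have h0 := combNorm_nonneg (c := c) (g := g) (2 * m : ℕ) α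
  refine ENNReal.toReal_le_of_le_ofReal (by positivity) ?_
  rw [eLpNorm_exponent_top]
  refine eLpNormEssSup_le_of_ae_bound (.of_forall fun z => ?_)
  refine le_of_pow_le_pow_left₀ hm2 (by positivity) ?_
  have h := norm_pow_mul_sphereMass_le hc hF m z
  rw [mul_pow, mul_pow, ← Real.rpow_natCast (_ ^ _), ← Real.rpow_mul hmass.le, neg_mul,
    one_div_mul_cancel (by exact_mod_cast hm2), Real.rpow_neg_one, mul_right_comm,
    ← div_eq_mul_inv, le_div_iff₀ hmass, combNorm_pow hgc hm2]
  refine h.trans (mul_le_mul_of_nonneg_right ?_ (integral_nonneg fun w => by positivity))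
  exact_mod_cast hN

end RandomCombinations

/-! ### Bounds for multiplier norms -/

section AdaptedBasis

variable {d M₁ M₂ s : ℕ} {c : ℝ≥0} {ξ : Fin s → CSphere d → ℂ} {deg : Fin s → ℕ}

lemma IsAdaptedBasis.mem_spherePolys (h : IsAdaptedBasis d c M₁ M₂ ξ deg) (k : Fin s) :
    ξ k ∈ spherePolys d (2 * M₂) := by
  refine harmonicBand_le_spherePolys d M₁ M₂ ?_
  have h1 : shell d (deg k) ≤ harmonicBand d M₁ M₂ := le_iSup₂_of_le (deg k) (h.deg_mem k) le_rfl
  refine h1 ?_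
  rw [← h.span_eq _ (h.deg_mem k)]
  exact Submodule.subset_span ⟨k, rfl, rfl⟩

lemma IsAdaptedBasis.isOrthonormalFamily (h : IsAdaptedBasis d c M₁ M₂ ξ deg) (l : ℕ) :
    IsOrthonormalFamily c fun k : {k // deg k = l} => ξ k :=
  ⟨fun k => continuous_of_mem_spherePolys (h.mem_spherePolys k), fun j k => by
    simpa [Subtype.ext_iff] using h.orthonormal j k⟩

lemma IsAdaptedBasis.span_range_eq (h : IsAdaptedBasis d c M₁ M₂ ξ deg) {l : ℕ}
    (hl : l ∈ Finset.Ioc M₁ M₂) :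
    Submodule.span ℂ (Set.range fun k : {k // deg k = l} => ξ k) = shell d l := by
  rw [← h.span_eq l hl, Set.image_eq_range]
  rfl

/-- The addition formula for a shell, on the diagonal. -/
lemma IsAdaptedBasis.sum_norm_sq_shell (h : IsAdaptedBasis d c M₁ M₂ ξ deg) {l : ℕ}
    (hl : l ∈ Finset.Ioc M₁ M₂) (z : CSphere d) :
    (∑ k with deg k = l, ‖ξ k z‖ ^ 2) * sphereMass d c = shellDim d l := by
  have hf := h.isOrthonormalFamily l
  have hspan := h.span_range_eq hl
  have h1 := hf.sum_norm_sq (by rw [hspan]; exact isRotationInvariant_shell l) z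
  rw [shellDim, ← hspan, finrank_span_eq_card hf.linearIndependent, ← h1]
  congr 1
  exact Finset.sum_subtype _ (by simp) fun k => ‖ξ k z‖ ^ 2

/-- The functions `λ̃_k ξ_k`. -/
noncomputable def scaledBasis (ξ : Fin s → CSphere d → ℂ) (deg : Fin s → ℕ) (lam : ℝ≥0 → ℝ)
    (k : Fin s) : CSphere d → ℂ :=
  (lam (deg k) : ℂ) • ξ k

lemma multiplierNorm_eq_combNorm (lam : ℝ≥0 → ℝ) (p : ℝ≥0∞) :
    multiplierNorm c ξ deg lam p = combNorm c (scaledBasis ξ deg lam) p := by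
  ext α
  unfold multiplierNorm combNorm
  congr 2
  ext z
  refine Finset.sum_congr rfl fun k _ => ?_
  simp only [multiplierOp, scaledBasis, Pi.smul_apply, smul_eq_mul]
  push_cast
  ring

lemma IsAdaptedBasis.scaledBasis_mem (h : IsAdaptedBasis d c M₁ M₂ ξ deg) (lam : ℝ≥0 → ℝ)
    (k : Fin s) : scaledBasis ξ deg lam k ∈ spherePolys d (2 * M₂) :=
  Submodule.smul_mem _ _ (h.mem_spherePolys k)

/-- The constant `s ω_d V`: summing the addition formula over the shells of the band. -/
lemma IsAdaptedBasis.sum_norm_sq_scaledBasis (h : IsAdaptedBasis d c M₁ M₂ ξ deg)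
    (lam : ℝ≥0 → ℝ) (z : CSphere d) :
    (∑ k, ‖scaledBasis ξ deg lam k z‖ ^ 2) * sphereMass d c
      = ∑ l ∈ Finset.Ioc M₁ M₂, lam l ^ 2 * (shellDim d l : ℝ) := by
  rw [← Finset.sum_fiberwise_of_maps_to (s := Finset.univ) (t := Finset.Ioc M₁ M₂) (g := deg)
    fun k _ => h.deg_mem k, Finset.sum_mul]
  refine Finset.sum_congr rfl fun l hl => ?_
  rw [← h.sum_norm_sq_shell hl z, ← mul_assoc, Finset.mul_sum]
  congr 1
  refine Finset.sum_congr rfl fun k hk => ?_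
  rw [(Finset.mem_filter.1 hk).2.symm]
  simp [scaledBasis, mul_pow]

end AdaptedBasis

lemma weightedMean_eq (d M₁ M₂ : ℕ) (w : ℕ → ℝ) :
    weightedMean d M₁ M₂ w =
      √((∑ l ∈ Finset.Ioc M₁ M₂, w l ^ 2 * (shellDim d l : ℝ)) / bandDim d M₁ M₂) := by
  have h : (0 : ℝ) ≤ bandDim d M₁ M₂ := by positivity
  rw [weightedMean, Real.rpow_neg h, ← Real.sqrt_eq_rpow, Real.sqrt_div' _ h, inv_mul_eq_div]

lemma weightedMean_mono {d M₁ M₂ : ℕ} {w w' : ℕ → ℝ} (hw : ∀ l, 0 ≤ w l) (h : ∀ l, w l ≤ w' l) :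
    weightedMean d M₁ M₂ w ≤ weightedMean d M₁ M₂ w' := by
  unfold weightedMean
  gcongr with l hl
  · exact hw l
  · exact h l

/-- The elementary estimate behind the choice `m = ⌈log s⌉` in the bound of the supremum norm: the
dimension of the space of polynomials containing the `m`-th powers is at most exponential
in `m`. -/
lemma exponential_dimension_bound {M s m : ℕ} (d : ℕ) (hM : M < s) (hm : m ≠ 0)
    (hs : Real.log s ≤ m) :
    ((m * (2 * M) + 1 : ℕ) : ℝ) ^ (2 * d) ≤ ((2 * Real.exp 1) ^ d) ^ (2 * m) := by
  have h1 : ((m * (2 * M) + 1 : ℕ) : ℝ) ≤ (2 * Real.exp 1) ^ m := by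
    have hs0 : (0 : ℝ) < s := by exact_mod_cast (Nat.zero_le M).trans_lt hM
    have h2 : m * (2 * M) + 1 ≤ 2 * m * s := by
      have : 2 * m * (M + 1) ≤ 2 * m * s := Nat.mul_le_mul_left _ hM
      have hm1 : 1 ≤ m := Nat.one_le_iff_ne_zero.2 hm
      nlinarith
    have h3 : 2 * m ≤ 2 ^ m := by
      obtain ⟨k, rfl⟩ := Nat.exists_eq_succ_of_ne_zero hm
      have := Nat.lt_two_pow_self (n := k)
      rw [pow_succ]
      omega
    have h4 : (s : ℝ) ≤ Real.exp 1 ^ m := by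
      rw [← Real.exp_nat_mul, mul_one]
      exact (Real.log_le_iff_le_exp hs0).1 hs
    calc ((m * (2 * M) + 1 : ℕ) : ℝ) ≤ ((2 * m : ℕ) : ℝ) * s := by exact_mod_cast h2
      _ ≤ 2 ^ m * Real.exp 1 ^ m := by
        gcongr
        exact_mod_cast h3
      _ = _ := (mul_pow _ _ _).symm
  calc _ ≤ ((2 * Real.exp 1) ^ m) ^ (2 * d) := by gcongr
    _ = _ := by rw [← pow_mul, ← pow_mul]; congr 1; ring

section Bounds

variable {d n : ℕ} {c : ℝ≥0} {g : Fin n → CSphere d → ℂ} {V : ℝ}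

/-- Lower bound for `p ≥ 2`, including `p = ∞`. -/
lemma le_levyMean_combNorm_of_two_le [NeZero n] (hd : 0 < d) (hc : 0 < c)
    (hg : ∀ k, Continuous (g k)) (hV : ∀ z, (∑ k, ‖g k z‖ ^ 2) / n = V) {p : ℝ≥0∞} (hp : 2 ≤ p) :
    sphereMass d c ^ (1 / p.toReal - 1 / 2) * √(sphereMass d c * V)
      ≤ levyMean (combNorm c g p) := by
  have hmass := sphereMass_pos hd hc
  have h := levyMean_le_mul (N := combNorm c g 2) (N' := combNorm c g p)
    (a := sphereMass d c ^ (1 / 2 - 1 / p.toReal)) (by positivity) (combNorm_nonneg _)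
    (continuous_combNorm hg (one_le_two.trans hp))
    fun α => by simpa using combNorm_le_rpow_mul_combNorm hg hp two_ne_zero α
  rw [levyMean_combNorm_two hg hV] at h
  calc _ ≤ sphereMass d c ^ (1 / p.toReal - 1 / 2) *
        (sphereMass d c ^ (1 / 2 - 1 / p.toReal) * levyMean (combNorm c g p)) := by gcongr
    _ = _ := by
      rw [← mul_assoc, ← Real.rpow_add hmass]
      simp

/-- Upper bound for `2 ≤ p < ∞`, by comparison with the least even exponent above `p`. -/
lemma levyMean_combNorm_le_of_two_le [NeZero n] (hd : 0 < d) (hc : 0 < c)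
    (hg : ∀ k, Continuous (g k)) (hV : ∀ z, (∑ k, ‖g k z‖ ^ 2) / n = V) (hV0 : 0 ≤ V) {p : ℝ}
    (hp : 2 ≤ p) :
    levyMean (combNorm c g (ENNReal.ofReal p)) ≤
      2 * sphereMass d c ^ (1 / p - 1 / 2) * p ^ (1 / 2 : ℝ) * √(sphereMass d c * V) := by
  have hmass := sphereMass_pos hd hc
  set m := ⌈p / 2⌉₊ with hmdef
  have hm1 : p ≤ ((2 * m : ℕ) : ℝ) := by
    have := Nat.le_ceil (p / 2)
    push_cast
    linarith
  have hm2 : (2 * m : ℝ) ≤ 2 * p := by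
    have := Nat.ceil_lt_add_one (show 0 ≤ p / 2 by linarith)
    linarith
  have hm0 : m ≠ 0 := by
    rintro h0
    rw [h0] at hm1
    norm_num at hm1
    linarith
  have hpo : (ENNReal.ofReal p).toReal = p := ENNReal.toReal_ofReal (by linarith)
  have hp0 : ENNReal.ofReal p ≠ 0 := by simp; linarith
  have h := levyMean_le_mul (N := combNorm c g (ENNReal.ofReal p))
    (N' := combNorm c g (2 * m : ℕ))
    (a := sphereMass d c ^ (1 / p - 1 / ((2 * m : ℕ) : ℝ))) (by positivity) (combNorm_nonneg _)
    (continuous_combNorm hg (by exact_mod_cast (by omega : 1 ≤ 2 * m)))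
    fun α => by
      have := combNorm_le_rpow_mul_combNorm (c := c) (p := ENNReal.ofReal p) (q := (2 * m : ℕ)) hg
        (ENNReal.ofReal_le_of_le_toReal (by simpa using hm1)) hp0 α
      rwa [hpo, ENNReal.toReal_natCast] at this
  refine h.trans ?_
  calc _ ≤ sphereMass d c ^ (1 / p - 1 / ((2 * m : ℕ) : ℝ)) *
        (sphereMass d c ^ (1 / (2 * m : ℕ) : ℝ) * √(2 * m) * √V) := by
        gcongr
        exact levyMean_combNorm_even_le hg hV hV0 hm0
    _ = sphereMass d c ^ (1 / p) * √(2 * m) * √V := by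
        rw [← mul_assoc, ← mul_assoc, ← Real.rpow_add hmass]
        congr 3
        ring
    _ ≤ sphereMass d c ^ (1 / p) * (2 * √p) * √V := by
        gcongr
        rw [Real.sqrt_le_left (by positivity), mul_pow, Real.sq_sqrt (by linarith)]
        linarith
    _ = _ := by
        rw [Real.sqrt_mul hmass.le, ← Real.sqrt_eq_rpow p, Real.sqrt_eq_rpow (sphereMass d c),
          show 1 / p = (1 / p - 1 / 2) + 1 / 2 by ring, Real.rpow_add hmass,
          add_sub_cancel_right]
        ring

/-- Upper bound for `p = ∞`, by comparison with an even exponent of order `log n`. -/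
lemma levyMean_combNorm_top_le [NeZero n] (hd : 0 < d) (hc : 0 < c) {M : ℕ}
    (hg : ∀ k, g k ∈ spherePolys d (2 * M)) (hM : M < n) (hn : 2 ≤ n)
    (hV : ∀ z, (∑ k, ‖g k z‖ ^ 2) / n = V) (hV0 : 0 ≤ V) :
    levyMean (combNorm c g ∞) ≤
      3 * (2 * Real.exp 1) ^ d * sphereMass d c ^ (-(1 / 2) : ℝ) *
        Real.log n ^ (1 / 2 : ℝ) * √(sphereMass d c * V) := by
  have hmass := sphereMass_pos hd hc
  have hgc := fun k => continuous_of_mem_spherePolys (hg k)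
  have hlog : 1 / 2 < Real.log n := by
    have h1 : Real.log 2 ≤ Real.log n := Real.log_le_log two_pos (by exact_mod_cast hn)
    have h2 := Real.log_two_gt_d9
    linarith
  set m := ⌈Real.log n⌉₊ with hmdef
  have hm0 : m ≠ 0 := (Nat.ceil_pos.2 (by linarith)).ne'
  have hm1 : Real.log n ≤ m := Nat.le_ceil _
  -- since `log n ≥ 1/2`, rounding up costs at most a factor `3`
  have hm2 : (2 * m : ℝ) ≤ 6 * Real.log n := by
    have := Nat.ceil_lt_add_one (show 0 ≤ Real.log n by linarith)
    linarith
  set B := (2 * Real.exp 1) ^ d with hB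
  have hB0 : 0 ≤ B := by positivity
  have h := levyMean_le_mul (N := combNorm c g ∞) (N' := combNorm c g (2 * m : ℕ))
    (a := B * sphereMass d c ^ (-(1 / (2 * m : ℕ)) : ℝ)) (by positivity) (combNorm_nonneg _)
    (continuous_combNorm hgc (by exact_mod_cast (by omega : 1 ≤ 2 * m)))
    (combNorm_top_le hc hd hg hm0 hB0 (exponential_dimension_bound d hM hm0 hm1))
  refine h.trans ?_
  calc _ ≤ B * sphereMass d c ^ (-(1 / (2 * m : ℕ)) : ℝ) *
        (sphereMass d c ^ (1 / (2 * m : ℕ) : ℝ) * √(2 * m) * √V) := by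
        gcongr
        exact levyMean_combNorm_even_le hgc hV hV0 hm0
    _ = B * √(2 * m) * √V := by
        rw [Real.rpow_neg hmass.le]
        have : sphereMass d c ^ (1 / (2 * m : ℕ) : ℝ) ≠ 0 := (Real.rpow_pos_of_pos hmass _).ne'
        field_simp
    _ ≤ B * (3 * √(Real.log n)) * √V := by
        gcongr
        rw [Real.sqrt_le_left (by positivity), mul_pow, Real.sq_sqrt (by linarith)]
        linarith
    _ = _ := by
        rw [Real.sqrt_mul hmass.le, ← Real.sqrt_eq_rpow (Real.log n), Real.rpow_neg hmass.le,
          ← Real.sqrt_eq_rpow]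
        have : √(sphereMass d c) ≠ 0 := (Real.sqrt_pos.2 hmass).ne'
        field_simp

/-- Lower bound for `p ≥ 1`, by comparison with `p = 1`. -/
lemma le_levyMean_combNorm_of_one_le [NeZero n] (hd : 0 < d) (hc : 0 < c)
    (hg : ∀ k, Continuous (g k)) (hV : ∀ z, (∑ k, ‖g k z‖ ^ 2) / n = V) {p : ℝ} (hp : 1 ≤ p) :
    sphereMass d c ^ (1 / p - 1 / 2) / 2 * √(sphereMass d c * V)
      ≤ levyMean (combNorm c g (ENNReal.ofReal p)) := by
  have hmass := sphereMass_pos hd hc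
  have hpo : (ENNReal.ofReal p).toReal = p := ENNReal.toReal_ofReal (by linarith)
  have hp' : 1 ≤ ENNReal.ofReal p := ENNReal.one_le_ofReal.2 hp
  have h := levyMean_le_mul (N := combNorm c g 1) (N' := combNorm c g (ENNReal.ofReal p))
    (a := sphereMass d c ^ (1 - 1 / p)) (by positivity) (combNorm_nonneg _)
    (continuous_combNorm hg hp')
    fun α => by simpa [hpo] using combNorm_le_rpow_mul_combNorm hg hp' one_ne_zero α
  have h2 := (le_levyMean_combNorm_one (c := c) hg hV).trans h
  calc _ = sphereMass d c ^ (1 / p - 1) * (sphereMass d c * (√V / 2)) := by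
        rw [Real.sqrt_mul hmass.le, Real.sqrt_eq_rpow (sphereMass d c), Real.rpow_sub hmass,
          Real.rpow_sub hmass, Real.rpow_one]
        have : sphereMass d c ^ (1 / 2 : ℝ) ≠ 0 := (Real.rpow_pos_of_pos hmass _).ne'
        field_simp
    _ ≤ sphereMass d c ^ (1 / p - 1) *
        (sphereMass d c ^ (1 - 1 / p) * levyMean (combNorm c g (ENNReal.ofReal p))) := by gcongr
    _ = _ := by
      rw [← mul_assoc, ← Real.rpow_add hmass]
      simp

lemma levyMean_combNorm_le_of_le_two [NeZero n]
    (hg : ∀ k, Continuous (g k)) (hV : ∀ z, (∑ k, ‖g k z‖ ^ 2) / n = V) {p : ℝ}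
    (hp : 1 ≤ p) (hp2 : p ≤ 2) :
    levyMean (combNorm c g (ENNReal.ofReal p)) ≤
      sphereMass d c ^ (1 / p - 1 / 2) * √(sphereMass d c * V) := by
  have hmass : 0 ≤ sphereMass d c := ENNReal.toReal_nonneg
  have hpo : (ENNReal.ofReal p).toReal = p := ENNReal.toReal_ofReal (by linarith)
  rw [← levyMean_combNorm_two hg hV]
  refine levyMean_le_mul (by positivity) (combNorm_nonneg _) (continuous_combNorm hg one_le_two)
    fun α => ?_
  have h := combNorm_le_rpow_mul_combNorm (c := c) (p := ENNReal.ofReal p) (q := 2) hg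
    (ENNReal.ofReal_le_of_le_toReal (by simpa using hp2)) (by simp; linarith) α
  rwa [hpo, ENNReal.toReal_ofNat] at h

end Bounds

/-- All the bounds, with the mean of the multipliers themselves on both sides. -/
lemma IsAdaptedBasis.levyMean_bounds {d M₁ M₂ : ℕ} {c : ℝ≥0} (hd : 2 ≤ d) (hc : 0 < c)
    (hM : M₁ < M₂) {ξ : Fin (bandDim d M₁ M₂) → CSphere d → ℂ}
    {deg : Fin (bandDim d M₁ M₂) → ℕ} (h : IsAdaptedBasis d c M₁ M₂ ξ deg) (lam : ℝ≥0 → ℝ) :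
    (∀ p : ℝ, 2 ≤ p →
      sphereMass d c ^ (1 / p - 1 / 2) * weightedMean d M₁ M₂ (fun l => lam l)
        ≤ levyMean (multiplierNorm c ξ deg lam (ENNReal.ofReal p)) ∧
      levyMean (multiplierNorm c ξ deg lam (ENNReal.ofReal p))
        ≤ 2 * sphereMass d c ^ (1 / p - 1 / 2) * p ^ (1 / 2 : ℝ) *
          weightedMean d M₁ M₂ (fun l => lam l)) ∧
    (sphereMass d c ^ (-(1 / 2) : ℝ) * weightedMean d M₁ M₂ (fun l => lam l)
        ≤ levyMean (multiplierNorm c ξ deg lam ∞) ∧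
      levyMean (multiplierNorm c ξ deg lam ∞)
        ≤ 3 * (2 * Real.exp 1) ^ d * sphereMass d c ^ (-(1 / 2) : ℝ) *
          Real.log (bandDim d M₁ M₂) ^ (1 / 2 : ℝ) *
          weightedMean d M₁ M₂ (fun l => lam l)) ∧
    (∀ p : ℝ, 1 ≤ p → p ≤ 2 →
      sphereMass d c ^ (1 / p - 1 / 2) / 2 * weightedMean d M₁ M₂ (fun l => lam l)
        ≤ levyMean (multiplierNorm c ξ deg lam (ENNReal.ofReal p)) ∧
      levyMean (multiplierNorm c ξ deg lam (ENNReal.ofReal p))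
        ≤ sphereMass d c ^ (1 / p - 1 / 2) * weightedMean d M₁ M₂ (fun l => lam l)) ∧
    levyMean (multiplierNorm c ξ deg lam 2) = weightedMean d M₁ M₂ (fun l => lam l) := by
  have hd0 : 0 < d := by omega
  have hmass := sphereMass_pos hd0 hc
  have hlt := lt_bandDim hd hM
  have : NeZero (bandDim d M₁ M₂) := ⟨by omega⟩
  have hmem := h.scaledBasis_mem lam
  have hg := fun k => continuous_of_mem_spherePolys (hmem k)
  obtain ⟨S, hS⟩ : ∃ S, S = ∑ l ∈ Finset.Ioc M₁ M₂, lam l ^ 2 * (shellDim d l : ℝ) := ⟨_, rfl⟩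
  have hS0 : 0 ≤ S := hS ▸ Finset.sum_nonneg fun l _ => by positivity
  obtain ⟨V, hVdef⟩ : ∃ V, V = S / sphereMass d c / bandDim d M₁ M₂ := ⟨_, rfl⟩
  have hV0 : 0 ≤ V := hVdef ▸ div_nonneg (div_nonneg hS0 hmass.le) (Nat.cast_nonneg _)
  have hV : ∀ z, (∑ k, ‖scaledBasis ξ deg lam k z‖ ^ 2) / (bandDim d M₁ M₂ : ℝ) = V := fun z => by
    rw [hVdef, hS, ← h.sum_norm_sq_scaledBasis lam z, mul_div_cancel_right₀ _ hmass.ne']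
  have hW : weightedMean d M₁ M₂ (fun l => lam l) = √(sphereMass d c * V) := by
    rw [weightedMean_eq, hVdef, ← hS, ← mul_div_assoc, mul_div_cancel₀ _ hmass.ne']
  simp_rw [multiplierNorm_eq_combNorm, hW]
  refine ⟨fun p hp => ⟨?_, levyMean_combNorm_le_of_two_le hd0 hc hg hV hV0 hp⟩, ⟨?_, ?_⟩,
    fun p hp hp2 => ⟨le_levyMean_combNorm_of_one_le hd0 hc hg hV hp,
      levyMean_combNorm_le_of_le_two hg hV hp hp2⟩, levyMean_combNorm_two hg hV⟩
  · have h1 := le_levyMean_combNorm_of_two_le hd0 hc hg hV (p := ENNReal.ofReal p)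
      (by simpa using ENNReal.ofReal_le_ofReal hp)
    rwa [ENNReal.toReal_ofReal (by linarith)] at h1
  · simpa using le_levyMean_combNorm_of_two_le hd0 hc hg hV (p := ∞) le_top
  · exact levyMean_combNorm_top_le hd0 hc hmem hlt (by omega) hV hV0

theorem mainTheorem8 :
    ∃ C : ℝ, 0 < C ∧ ∀ d : ℕ, 2 ≤ d → ∃ C' : ℝ, 0 < C' ∧
      ∀ (c : ℝ≥0), 0 < c → ∀ (M₁ M₂ : ℕ), M₁ < M₂ →
      ∀ (ξ : Fin (bandDim d M₁ M₂) → CSphere d → ℂ) (deg : Fin (bandDim d M₁ M₂) → ℕ),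
      IsAdaptedBasis d c M₁ M₂ ξ deg →
      ∀ lam : ℝ≥0 → ℝ, (∀ t, 0 < lam t) →
      (Antitone lam →
        (∀ p : ℝ, 2 ≤ p →
          sphereMass d c ^ (1 / p - 1 / 2) * weightedMean d M₁ M₂ (fun l => lam l)
            ≤ levyMean (multiplierNorm c ξ deg lam (ENNReal.ofReal p)) ∧
          levyMean (multiplierNorm c ξ deg lam (ENNReal.ofReal p))
            ≤ C * sphereMass d c ^ (1 / p - 1 / 2) * p ^ (1 / 2 : ℝ) *
              weightedMean d M₁ M₂ (fun l => lam ((l - 1 : ℕ) : ℝ≥0))) ∧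
        (sphereMass d c ^ (-(1 / 2) : ℝ) * weightedMean d M₁ M₂ (fun l => lam l)
            ≤ levyMean (multiplierNorm c ξ deg lam ∞) ∧
          levyMean (multiplierNorm c ξ deg lam ∞)
            ≤ C' * sphereMass d c ^ (-(1 / 2) : ℝ) *
              Real.log (bandDim d M₁ M₂) ^ (1 / 2 : ℝ) *
              weightedMean d M₁ M₂ (fun l => lam ((l - 1 : ℕ) : ℝ≥0))) ∧
        (∀ p : ℝ, 1 ≤ p → p ≤ 2 →
          sphereMass d c ^ (1 / p - 1 / 2) / 2 * weightedMean d M₁ M₂ (fun l => lam l)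
            ≤ levyMean (multiplierNorm c ξ deg lam (ENNReal.ofReal p)) ∧
          levyMean (multiplierNorm c ξ deg lam (ENNReal.ofReal p))
            ≤ sphereMass d c ^ (1 / p - 1 / 2) *
              weightedMean d M₁ M₂ (fun l => lam ((l - 1 : ℕ) : ℝ≥0))) ∧
        (weightedMean d M₁ M₂ (fun l => lam l)
            ≤ levyMean (multiplierNorm c ξ deg lam 2) ∧
          levyMean (multiplierNorm c ξ deg lam 2)
            ≤ weightedMean d M₁ M₂ (fun l => lam ((l - 1 : ℕ) : ℝ≥0)))) ∧
      (Monotone lam →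
        (∀ p : ℝ, 2 ≤ p →
          sphereMass d c ^ (1 / p - 1 / 2) *
              weightedMean d M₁ M₂ (fun l => lam ((l - 1 : ℕ) : ℝ≥0))
            ≤ levyMean (multiplierNorm c ξ deg lam (ENNReal.ofReal p)) ∧
          levyMean (multiplierNorm c ξ deg lam (ENNReal.ofReal p))
            ≤ C * sphereMass d c ^ (1 / p - 1 / 2) * p ^ (1 / 2 : ℝ) *
              weightedMean d M₁ M₂ (fun l => lam l)) ∧
        (sphereMass d c ^ (-(1 / 2) : ℝ) *
              weightedMean d M₁ M₂ (fun l => lam ((l - 1 : ℕ) : ℝ≥0))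
            ≤ levyMean (multiplierNorm c ξ deg lam ∞) ∧
          levyMean (multiplierNorm c ξ deg lam ∞)
            ≤ C' * sphereMass d c ^ (-(1 / 2) : ℝ) *
              Real.log (bandDim d M₁ M₂) ^ (1 / 2 : ℝ) *
              weightedMean d M₁ M₂ (fun l => lam l)) ∧
        (∀ p : ℝ, 1 ≤ p → p ≤ 2 →
          sphereMass d c ^ (1 / p - 1 / 2) / 2 *
              weightedMean d M₁ M₂ (fun l => lam ((l - 1 : ℕ) : ℝ≥0))
            ≤ levyMean (multiplierNorm c ξ deg lam (ENNReal.ofReal p)) ∧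
          levyMean (multiplierNorm c ξ deg lam (ENNReal.ofReal p))
            ≤ sphereMass d c ^ (1 / p - 1 / 2) *
              weightedMean d M₁ M₂ (fun l => lam l)) ∧
        (weightedMean d M₁ M₂ (fun l => lam ((l - 1 : ℕ) : ℝ≥0))
            ≤ levyMean (multiplierNorm c ξ deg lam 2) ∧
          levyMean (multiplierNorm c ξ deg lam 2)
            ≤ weightedMean d M₁ M₂ (fun l => lam l))) := by
  refine ⟨2, two_pos, fun d hd => ⟨3 * (2 * Real.exp 1) ^ d, by positivity, ?_⟩⟩
  intro c hc M₁ M₂ hM ξ deg hξ lam hlam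
  obtain ⟨h1, h2, h3, h4⟩ := hξ.levyMean_bounds hd hc hM lam
  have hmass := sphereMass_pos (by omega : 0 < d) hc
  have hlog : 0 ≤ Real.log (bandDim d M₁ M₂) := Real.log_natCast_nonneg _
  have hpred : ∀ l : ℕ, ((l - 1 : ℕ) : ℝ≥0) ≤ l := fun l => by exact_mod_cast Nat.sub_le l 1
  constructor
  · intro hanti
    have hW : weightedMean d M₁ M₂ (fun l => lam l) ≤
        weightedMean d M₁ M₂ (fun l => lam ((l - 1 : ℕ) : ℝ≥0)) :=
      weightedMean_mono (fun l => (hlam _).le) fun l => hanti (hpred l)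
    refine ⟨fun p hp => ⟨(h1 p hp).1, (h1 p hp).2.trans ?_⟩, ⟨h2.1, h2.2.trans ?_⟩,
      fun p hp hp2 => ⟨(h3 p hp hp2).1, (h3 p hp hp2).2.trans ?_⟩, h4.ge, h4.trans_le hW⟩ <;>
    gcongr
  · intro hmono
    have hW : weightedMean d M₁ M₂ (fun l => lam ((l - 1 : ℕ) : ℝ≥0)) ≤
        weightedMean d M₁ M₂ (fun l => lam l) :=
      weightedMean_mono (fun l => (hlam _).le) fun l => hmono (hpred l)
    refine ⟨fun p hp => ⟨le_trans ?_ (h1 p hp).1, (h1 p hp).2⟩, ⟨le_trans ?_ h2.1, h2.2⟩,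
      fun p hp hp2 => ⟨le_trans ?_ (h3 p hp hp2).1, (h3 p hp hp2).2⟩, hW.trans h4.ge, h4.le⟩ <;>
    gcongr
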